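/- Let $\mathcal H$ be a complex Hilbert space (of finite or infinite dimension), and let $\mathcal V,\mathcal W\subset\mathcal H$ be finite dimensional subspaces such that $\mathcal V\oplus\mathcal W^\perp=\mathcal H$ (algebraic direct sum, not necessarily orthogonal); put $d=\dim\mathcal V=\dim\mathcal W$. Let $\mathcal F=\{f_i\}_{i=1}^n\in\mathcal W^n$ be a frame for $\mathcal W$. Notation. For a finite sequence $\mathcal G=\{g_i\}_{i=1}^n$ in $\mathcal H$ let $S_{\mathcal G}f=\sum_i\langle f,g_i\rangle g_i$ be its frame operator. Let $\lambda(S_{\mathcal G})=(\lambda_1(S_{\mathcal G}),\lambda_2(S_{\mathcal G}),\dots)$ be the eigenvalues of the compression of $S_{\mathcal G}$ to $\mathrm{Span}\{g_i\}$, with multiplicities and in non-increasing order, followed by zeros, and for $h:[0,\infty)\to[0,\infty)$ let $$P_h(\mathcal G)=\sum_{i=1}^{\dim \mathrm{Span}\{g_i\}}h(\lambda_i(S_{\mathcal G})).$$ For a sequence $\mathcal G$ in $\mathcal W$, its canonical $\mathcal V$-dual is $\mathcal G^\#_{\mathcal V}=\{P_{\mathcal V/\!/\mathcal W^\perp}S_{\mathcal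 G}^\dagger g_i\}_{i=1}^n$, where $P_{\mathcal V/\!/\mathcal W^\perp}$ is the projection with range $\mathcal V$ and null space $\mathcal W^\perp$, and $\dagger$ is the Moore–Penrose pseudo-inverse. Write $\lambda_j=\lambda_j(S_{\mathcal F})$, and $U\cdot\mathcal F=\{Uf_i\}_{i=1}^n$. With $P_{\mathcal V},P_{\mathcal W}$ the orthogonal projections onto $\mathcal V,\mathcal W$ and $|T|=(T^*T)^{1/2}$, the principal angles $0\le\theta_1\le\dots\le\theta_d\le\pi/2$ are defined by the condition that $\cos\theta_1\ge\dots\ge\cos\theta_d$ are the eigenvalues, with multiplicities, of $|P_{\mathcal W}P_{\mathcal V}|$ restricted to $\mathcal V$. Principal vectors between $\mathcal V$ and $\mathcal W$ are orthonormal bases $\{v_j\}_{j=1}^d$ of $\mathcal V$ and $\{w_j\}_{j=1}^d$ of $\mathcal W$ such that, for every $j$, $|P_{\mathcal W}P_{\mathcal V}|v_j=\cos(\theta_j)v_j$, $|P_{\mathcal V}P_{\mathcal W}|w_j=\cos(\theta_j)w_j$, $P_{\mathcal W}v_j=\cos(\theta_j)w_j$ and $P_{\mathcal V}w_j=\cos(\theta_j)v_j$.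 Theorem. (a) Let $\{v_j\},\{w_j\}$ be principal vectors between $\mathcal V$ and $\mathcal W$, let $\{x_j\}_{j=1}^d$ be an orthonormal basis of $\mathcal W$ with $S_{\mathcal F}x_j=\lambda_jx_j$ for $1\le j\le d$, and let $U_0$ be a unitary operator on $\mathcal H$ with $U_0x_j=w_{d-j+1}$ for $1\le j\le d$. Then: 1. $\lambda(S_{(U_0\cdot\mathcal F)^\#_{\mathcal V}})=\big((\cos^{-2}(\theta_j)\,\lambda_{d-j+1}^{-1})_{1\le j\le d}^{\downarrow},0,0,\dots\big)$, where $\downarrow$ denotes non-increasing rearrangement. 2. For every non-decreasing convex function $h:[0,\infty)\to[0,\infty)$, $$P_h((U_0\cdot\mathcal F)^\#_{\mathcal V})=\min\{P_h((U\cdot\mathcal F)^\#_{\mathcal V}):\ U \text{ unitary on }\mathcal H,\ U(\mathcal W)=\mathcal W\}.$$ (b) Let $h:[0,\infty)\to[0,\infty)$ be non-decreasing and strictly convex, and let $U$ be a unitary operator on $\mathcal H$ with $U(\mathcal W)=\mathcal W$ that attains the minimum in 2. Then there exist principal vectors $\{v_j'\},\{w_j'\}$ between $\mathcal V$ and $\mathcal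 W$ and an orthonormal basis $\{x_j'\}_{j=1}^d$ of $\mathcal W$ such that $S_{\mathcal F}x_j'=\lambda_jx_j'$ and $Ux_j'=w'_{d-j+1}$ for $1\le j\le d$. -/

import Mathlib

noncomputable section

namespace ObliqueDual

variable {H : Type*} [NormedAddCommGroup H] [InnerProductSpace ℂ H] [CompleteSpace H]

/-- The synthesis operator `T_F a = ∑ i, a i • F i` of a finite sequence of vectors. -/
def synthesis {n : ℕ} (F : Fin n → H) : EuclideanSpace ℂ (Fin n) →L[ℂ] H :=
  ∑ i, (EuclideanSpace.proj i : EuclideanSpace ℂ (Fin n) →L[ℂ] ℂ).smulRight (F i)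

/-- The frame operator `S_F = T_F T_F^*`. -/
def frameOperator {n : ℕ} (F : Fin n → H) : H →L[ℂ] H :=
  synthesis F ∘L ContinuousLinearMap.adjoint (synthesis F)

theorem isSelfAdjoint_frameOperator {n : ℕ} (F : Fin n → H) :
    IsSelfAdjoint (frameOperator F) := by
  rw [ContinuousLinearMap.isSelfAdjoint_iff']
  simp [frameOperator, ContinuousLinearMap.adjoint_comp]

/-- `F` is a frame for the subspace `W`: a sequence in `W` with `0 < A < B` such that
`A ‖f‖² ≤ ∑ i, |⟨f, F i⟩|² ≤ B ‖f‖²` for every `f ∈ W`. -/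
def IsFrameFor {n : ℕ} (F : Fin n → H) (W : Submodule ℂ H) : Prop :=
  (∀ i, F i ∈ W) ∧ ∃ A B : ℝ, 0 < A ∧ A < B ∧ ∀ f ∈ W,
    A * ‖f‖ ^ 2 ≤ ∑ i, ‖inner ℂ (F i) f‖ ^ 2 ∧ ∑ i, ‖inner ℂ (F i) f‖ ^ 2 ≤ B * ‖f‖ ^ 2

/-- The four Penrose equations: `B` is the Moore-Penrose pseudo-inverse of `A`. -/
structure IsMoorePenrose (A B : H →L[ℂ] H) : Prop where
  mul_mul_left : A * B * A = A
  mul_mul_right : B * A * B = B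
  selfAdjoint_left : IsSelfAdjoint (A * B)
  selfAdjoint_right : IsSelfAdjoint (B * A)

theorem IsMoorePenrose.unique {A B C : H →L[ℂ] H}
    (hB : IsMoorePenrose A B) (hC : IsMoorePenrose A C) : B = C := by
  have h1 : A * B = A * C := by
    have e1 : star (A * B) = A * B := hB.selfAdjoint_left
    have e2 : star (A * C) = A * C := hC.selfAdjoint_left
    calc A * B = (A * C) * (A * B) := by
            rw [← mul_assoc, hC.mul_mul_left]
      _ = star ((A * B) * (A * C)) := by rw [star_mul, e1, e2]
      _ = star (A * C) := by rw [← mul_assoc, hB.mul_mul_left]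
      _ = A * C := e2
  have h2 : B * A = C * A := by
    have e1 : star (B * A) = B * A := hB.selfAdjoint_right
    have e2 : star (C * A) = C * A := hC.selfAdjoint_right
    calc B * A = (B * A) * (C * A) := by
            rw [mul_assoc B A (C * A), ← mul_assoc A C A, hC.mul_mul_left]
      _ = star ((C * A) * (B * A)) := by rw [star_mul, e1, e2]
      _ = star (C * A) := by rw [mul_assoc C A (B * A), ← mul_assoc A B A, hB.mul_mul_left]
      _ = C * A := e2
  calc B = B * A * B := hB.mul_mul_right.symm
    _ = C * A * C := by rw [h2, mul_assoc, h1, ← mul_assoc]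
    _ = C := hC.mul_mul_right

open Classical in
/-- The Moore-Penrose pseudo-inverse `A†` (with the value `0` if there is none, that is, if the
range of `A` is not closed; this does not happen for operators of finite rank). -/
def pinv (A : H →L[ℂ] H) : H →L[ℂ] H :=
  if h : ∃ B, IsMoorePenrose A B then h.choose else 0

/-- The canonical `V`-dual `i ↦ P_{V // Wᗮ} (S_F† (F i))` of `F`, where `P_{V // Wᗮ}` is the oblique
projection with range `V` and null space `Wᗮ`. -/
def canonicalDual {V W : Submodule ℂ H} (hVW : IsCompl V Wᗮ) {n : ℕ} (F : Fin n → H) :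
    Fin n → H :=
  fun i => V.projection Wᗮ hVW (pinv (frameOperator F) (F i))


/-- The compression of the operator `T` to the finite dimensional subspace `K`. -/
def compression (T : H →L[ℂ] H) (K : Submodule ℂ H) [FiniteDimensional ℂ K] : K →ₗ[ℂ] K :=
  (K.orthogonalProjectionOnto ∘L T ∘L K.subtypeL : K →L[ℂ] K).toLinearMap

theorem compression_isSymmetric {T : H →L[ℂ] H} (hT : IsSelfAdjoint T) (K : Submodule ℂ H)
    [FiniteDimensional ℂ K] : (compression T K).IsSymmetric := by
  intro x y
  have := hT.isSymmetric (x : H) (y : H)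
  simpa [compression] using this

/-- The eigenvalues of the compression of the self-adjoint operator `T` to `K`, with multiplicities
and in non-increasing order, followed by zeros (positions are counted from `0`). -/
def eigSeq {T : H →L[ℂ] H} (hT : IsSelfAdjoint T) (K : Submodule ℂ H) [FiniteDimensional ℂ K] :
    ℕ → ℝ :=
  fun i => if hi : i < Module.finrank ℂ K then
    (compression_isSymmetric hT K).eigenvalues rfl ⟨i, hi⟩ else 0

instance finiteDimensional_span_range {n : ℕ} (F : Fin n → H) :
    FiniteDimensional ℂ (Submodule.span ℂ (Set.range F)) :=
  FiniteDimensional.span_of_finite ℂ (Set.finite_range F)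

/-- The list `λ(S_F)`: the eigenvalues of the compression of `S_F` to the span of `F`, in
non-increasing order, followed by zeros. -/
def frameEig {n : ℕ} (F : Fin n → H) : ℕ → ℝ :=
  eigSeq (isSelfAdjoint_frameOperator F) (Submodule.span ℂ (Set.range F))

/-- The convex potential `P_h(F) = ∑_{i ≤ d} h(λ_i(S_F))`, with `d` the dimension of the span. -/
def convexPotential (h : ℝ → ℝ) {n : ℕ} (F : Fin n → H) : ℝ :=
  ∑ i ∈ Finset.range (Module.finrank ℂ (Submodule.span ℂ (Set.range F))), h (frameEig F i)

/-- The modulus `|P_W P_V|` of the product of two orthogonal projections. -/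
def absProj (W V : Submodule ℂ H) [FiniteDimensional ℂ W] [FiniteDimensional ℂ V] : H →L[ℂ] H :=
  CFC.abs (W.starProjection * V.starProjection)

theorem isSelfAdjoint_absProj (W V : Submodule ℂ H) [FiniteDimensional ℂ W]
    [FiniteDimensional ℂ V] : IsSelfAdjoint (absProj W V) :=
  IsSelfAdjoint.of_nonneg (CFC.abs_nonneg _)

/-- The principal angles `θ_1 ≤ ⋯ ≤ θ_d` in `[0, π/2]` between `V` and `W`, whose cosines are the
eigenvalues in non-increasing order of `|P_W P_V|` on `V` (positions are counted from `0`). -/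
def principalAngle (V W : Submodule ℂ H) [FiniteDimensional ℂ V] [FiniteDimensional ℂ W] : ℕ → ℝ :=
  fun i => Real.arccos (eigSeq (isSelfAdjoint_absProj W V) V i)

/-- The family `x` is an orthonormal basis of the subspace `K`. -/
def IsONBOf {d : ℕ} (x : Fin d → H) (K : Submodule ℂ H) : Prop :=
  Orthonormal ℂ x ∧ Submodule.span ℂ (Set.range x) = K

/-- `v` and `w` are (corresponding) principal vectors between `V` and `W`. -/
structure IsPrincipalVectors {d : ℕ} (V W : Submodule ℂ H) [FiniteDimensional ℂ V]
    [FiniteDimensional ℂ W] (v w : Fin d → H) : Prop where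
  onb_v : IsONBOf v V
  onb_w : IsONBOf w W
  abs_v : ∀ i, absProj W V (v i) = (Real.cos (principalAngle V W i) : ℂ) • v i
  abs_w : ∀ i, absProj V W (w i) = (Real.cos (principalAngle V W i) : ℂ) • w i
  proj_v : ∀ i, W.starProjection (v i) = (Real.cos (principalAngle V W i) : ℂ) • w i
  proj_w : ∀ i, V.starProjection (w i) = (Real.cos (principalAngle V W i) : ℂ) • v i

/-- The non-increasing rearrangement of `x`. -/
def rearrangeDesc {d : ℕ} (x : Fin d → ℝ) : Fin d → ℝ :=
  fun i => x (Tuple.sort x i.rev)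

/-- Extension of a finite vector by zeros. -/
def padZero {d : ℕ} (x : Fin d → ℝ) : ℕ → ℝ :=
  fun i => if hi : i < d then x ⟨i, hi⟩ else 0

/-- The potentials `P_h` of the canonical `V`-duals of all the rotations `U · F`, where `U` is a
unitary operator on the whole space such that `U(W) = W`. -/
def rotationPotentials {V W : Submodule ℂ H} (hVW : IsCompl V Wᗮ) {n : ℕ} (F : Fin n → H)
    (h : ℝ → ℝ) : Set ℝ :=
  {r | ∃ U : H ≃ₗᵢ[ℂ] H, W.map (U.toLinearEquiv : H →ₗ[ℂ] H) = W ∧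
    r = convexPotential h (canonicalDual hVW fun i => U (F i))}

end ObliqueDual

end

noncomputable section

namespace ObliqueDual

open Finset ContinuousLinearMap

/-! Let `P` be the oblique projection onto `V` along `Wᗮ` and `S` the frame operator of a rotated
frame, with eigenvalues `λ` on `W`. The dual has frame operator `P S† P*`; let `m` be its
eigenvalues on `V` and `g` an orthonormal eigenbasis. The vectors `u i = (m i)^(-1/2) P* (g i)` of
`W` diagonalize two forms at once (`exists_dual_eigenvalues`): on `W`, `S = ∑ u i ⊗ (u i)*` and `P*
P = ∑ m i • u i ⊗ (u i)*`. The eigenvalues `β` of `P* P` on `W` are the `cos⁻² θ`, so everything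
reduces to comparing `m` with the quotients `β / λ` of equally ordered spectra.

Lower bound. The operator with weights `max (m i) t` dominates both `P* P` and `t S`, so Weyl's
principle bounds its eigenvalues below by `max (β i) (t λ i)`, while its determinant is `∏ λ i * ∏
max (m i) t`. Hence `∏ max (β i / λ i) t ≤ ∏ max (m i) t` for all `t > 0` (`prod_max_le_prod_max`).
This is weak majorization of logarithms, which subgradients and Abel summation turn into the
inequality for every non-decreasing convex `h` (`sum_convex_le`). Principal vectors aligned with
eigenvectors of `S` attain it.

Equality. Strict convexity forces `m` to be the sorted `β / λ`, so `S + P* P` on `W` has determinant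
`∏ (λ i + β i)`. Ky Fan's inequality and strict Schur concavity of the product then give a common
ordered eigenbasis (`exists_common_eigenbasis`), and ordered eigenvectors of `P* P` are principal
vectors. -/

/-! ### Abel summation, subgradients and weak majorization of logarithms -/

theorem mul_sum_le_sum_mul_of_antitone {d : ℕ} (c δ : Fin d → ℝ) (hc : Antitone c)
    (hδ : ∀ k ≤ d, 0 ≤ ∑ i : Fin d, if (i : ℕ) < k then δ i else 0)
    (a : ℝ) (ha : ∀ i, a ≤ c i) : a * ∑ i, δ i ≤ ∑ i, c i * δ i := by
  induction d generalizing a with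
  | zero => simp
  | succ d ih =>
    have hδ' : ∀ k ≤ d, 0 ≤ ∑ i : Fin d, if (i : ℕ) < k then δ i.castSucc else 0 := by
      intro k hk
      have := hδ k (by omega)
      rw [Fin.sum_univ_castSucc] at this
      simpa [hk.not_gt] using this
    -- The last coefficient is a lower bound for the earlier ones; it is lowered to `a` only after
    -- the full sum of `δ` is available.
    have h1 := ih (fun i => c i.castSucc) (fun i => δ i.castSucc)
      (fun i j hij => hc (Fin.castSucc_le_castSucc_iff.2 hij)) hδ' (c (Fin.last d))
      (fun i => hc (Fin.le_last _))
    have h2 : 0 ≤ ∑ i, δ i := by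
      have := hδ (d + 1) le_rfl
      simpa [fun i : Fin (d + 1) => i.isLt] using this
    rw [Fin.sum_univ_castSucc (fun i => c i * δ i)]
    have h3 := mul_le_mul_of_nonneg_right (ha (Fin.last d)) h2
    rw [Fin.sum_univ_castSucc, mul_add, mul_add] at h3
    rw [Fin.sum_univ_castSucc, mul_add]
    linarith

/-- Abel summation in its two uses: weak majorization needs nonnegative coefficients, while full
majorization allows any sign because a constant shift of `c` costs nothing. -/
theorem sum_mul_nonneg_of_antitone {d : ℕ} (c δ : Fin d → ℝ) (hc : Antitone c)
    (hδ : ∀ k ≤ d, 0 ≤ ∑ i : Fin d, if (i : ℕ) < k then δ i else 0)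
    (h : (∀ i, 0 ≤ c i) ∨ ∑ i, δ i = 0) : 0 ≤ ∑ i, c i * δ i := by
  rcases h with h | h
  · simpa using mul_sum_le_sum_mul_of_antitone c δ hc hδ 0 h
  · have := mul_sum_le_sum_mul_of_antitone c δ hc hδ (-∑ i, |c i|) fun i =>
      (neg_le_neg (single_le_sum (f := fun i => |c i|) (fun _ _ => abs_nonneg _)
        (mem_univ i))).trans (neg_abs_le _)
    simpa [h] using this

theorem exists_subgradient {h : ℝ → ℝ} (hh : ConvexOn ℝ (Set.Ici 0) h) {z : ℝ} (hz : 0 < z) :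
    ∃ c, ∀ y, 0 ≤ y → c * (y - z) ≤ h y - h z := by
  have hzi : z ∈ interior (Set.Ici (0 : ℝ)) := by simpa using hz
  refine ⟨derivWithin h (Set.Ioi z) z, fun y hy => ?_⟩
  rcases lt_trichotomy y z with hyz | rfl | hyz
  · have h1 := hh.slope_le_leftDeriv_of_mem_interior (Set.mem_Ici.2 hy) hzi hyz
    have h2 := h1.trans (hh.leftDeriv_le_rightDeriv_of_mem_interior hzi)
    rw [slope_def_field, div_le_iff₀ (by linarith)] at h2
    linarith
  · simp
  · have h1 := hh.rightDeriv_le_slope_of_mem_interior hzi (Set.mem_Ici.2 hy) hyz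
    rw [slope_def_field, le_div_iff₀ (by linarith)] at h1
    exact h1

theorem subgradient_lt {h : ℝ → ℝ} (hh : StrictConvexOn ℝ (Set.Ici 0) h) {z c : ℝ} (hz : 0 < z)
    (hc : ∀ y, 0 ≤ y → c * (y - z) ≤ h y - h z) {y : ℝ} (hy : 0 ≤ y) (hyz : y ≠ z) :
    c * (y - z) < h y - h z := by
  have h1 := hh.2 (Set.mem_Ici.2 hy) (Set.mem_Ici.2 hz.le) hyz
    (by norm_num : (0 : ℝ) < 1 / 2) (by norm_num : (0 : ℝ) < 1 / 2) (by norm_num)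
  simp only [smul_eq_mul] at h1
  have h2 := hc (1 / 2 * y + 1 / 2 * z) (by positivity)
  linarith

/-- A multiplicative form of weak majorization, tested on truncations, gives inequalities between
partial sums of logarithms. -/
theorem sum_log_partial_le {d : ℕ} {m z : Fin d → ℝ} (hm : ∀ i, 0 < m i) (hz : ∀ i, 0 < z i)
    (hma : Antitone m) (H : ∀ t, 0 < t → ∏ i, max (z i) t ≤ ∏ i, max (m i) t) (k : ℕ)
    (hk : k ≤ d) :
    0 ≤ ∑ i : Fin d, if (i : ℕ) < k then Real.log (m i) - Real.log (z i) else 0 := by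
  rcases k with _ | k
  · simp
  set t := m ⟨k, hk⟩ with ht
  have ht0 : 0 < t := hm _
  have h1 := Real.log_le_log (prod_pos fun i _ => lt_max_of_lt_right ht0) (H t ht0)
  rw [Real.log_prod fun i _ => (lt_max_of_lt_right ht0).ne',
    Real.log_prod fun i _ => (lt_max_of_lt_right ht0).ne'] at h1
  -- Truncating at `t = m k` makes the terms beyond position `k` nonpositive, so dropping them can
  -- only increase the sum.
  rw [← sub_nonneg, ← sum_sub_distrib] at h1
  refine h1.trans (sum_le_sum fun i _ => ?_)
  split_ifs with hi
  · have : t ≤ m i := hma (Fin.le_def.2 (by simp only; omega))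
    rw [max_eq_left this]
    have := Real.log_le_log (hz i) (le_max_left (z i) t)
    linarith
  · have : m i ≤ t := hma (Fin.le_def.2 (by simp only; omega))
    rw [max_eq_right this]
    have := Real.log_le_log ht0 (le_max_right (z i) t)
    linarith

section Convex

variable {d : ℕ} {m z : Fin d → ℝ} (hm : ∀ i, 0 < m i) (hz : ∀ i, 0 < z i)
  (hma : Antitone m) (hza : Antitone z)
  (H : ∀ t, 0 < t → ∏ i, max (z i) t ≤ ∏ i, max (m i) t) {h : ℝ → ℝ}

/-- The slope is a function of the value `z i`, not of the index, so ties in `z` receive equal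
slopes and the slopes are antitone along `z`. -/
theorem exists_subgradients (hz : ∀ i, 0 < z i) (hh : ConvexOn ℝ (Set.Ici 0) h) :
    ∃ c : ℝ → ℝ, ∀ i, ∀ y, 0 ≤ y → c (z i) * (y - z i) ≤ h y - h (z i) := by
  have (t : ℝ) : ∃ c, 0 < t → ∀ y, 0 ≤ y → c * (y - t) ≤ h y - h t := by
    by_cases ht : 0 < t
    · obtain ⟨c, hc⟩ := exists_subgradient hh ht
      exact ⟨c, fun _ => hc⟩
    · exact ⟨0, fun h => absurd h ht⟩
  choose c hc using this
  exact ⟨c, fun i => hc _ (hz i)⟩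

include hm hz hma hza H in
-- The tangent bound `z log (m / z) ≤ m - z` reduces the claim to Abel summation of the log
-- differences against `c (z i) * z i`, which is nonnegative because `h` is non-decreasing and
-- antitone because the slopes and `z` are.
theorem sum_subgradient_nonneg (hmon : MonotoneOn h (Set.Ici 0)) {c : ℝ → ℝ}
    (hc : ∀ i, ∀ y, 0 ≤ y → c (z i) * (y - z i) ≤ h y - h (z i)) :
    0 ≤ ∑ i, c (z i) * (m i - z i) := by
  have hc0 (i) : 0 ≤ c (z i) := by
    have h1 := hc i (z i / 2) (by linarith [hz i])
    have h2 := hmon (Set.mem_Ici.2 (by linarith [hz i])) (Set.mem_Ici.2 (hz i).le)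
      (by linarith [hz i] : z i / 2 ≤ z i)
    by_contra! h3
    nlinarith [mul_pos_of_neg_of_neg h3 (by linarith [hz i] : z i / 2 - z i < 0)]
  have hca {i j} (hij : i ≤ j) : c (z j) ≤ c (z i) := by
    rcases (hza hij).eq_or_lt with h1 | h1
    · rw [h1]
    · have h2 := hc i (z j) (hz j).le
      have h3 := hc j (z i) (hz i).le
      by_contra! h4
      nlinarith [mul_pos (sub_pos.2 h4) (sub_pos.2 h1)]
  have key : 0 ≤ ∑ i, (c (z i) * z i) * (Real.log (m i) - Real.log (z i)) := by
    refine sum_mul_nonneg_of_antitone _ _ (fun i j hij => ?_) (sum_log_partial_le hm hz hma H)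
      (Or.inl fun i => mul_nonneg (hc0 i) (hz i).le)
    exact mul_le_mul (hca hij) (hza hij) (hz j).le (hc0 i)
  refine key.trans (sum_le_sum fun i _ => ?_)
  rw [mul_assoc]
  refine mul_le_mul_of_nonneg_left ?_ (hc0 i)
  rw [← Real.log_div (hm i).ne' (hz i).ne']
  have := Real.log_le_sub_one_of_pos (div_pos (hm i) (hz i))
  calc z i * Real.log (m i / z i) ≤ z i * (m i / z i - 1) :=
        mul_le_mul_of_nonneg_left this (hz i).le
    _ = m i - z i := by have := (hz i).ne'; field_simp

include hm hz hma hza H in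
theorem sum_convex_le (hh : ConvexOn ℝ (Set.Ici 0) h) (hmon : MonotoneOn h (Set.Ici 0)) :
    ∑ i, h (z i) ≤ ∑ i, h (m i) := by
  obtain ⟨c, hc⟩ := exists_subgradients hz hh
  have h1 := sum_subgradient_nonneg hm hz hma hza H hmon hc
  have h2 : ∑ i, c (z i) * (m i - z i) ≤ ∑ i, (h (m i) - h (z i)) :=
    sum_le_sum fun i _ => hc i _ (hm i).le
  rw [sum_sub_distrib] at h2
  linarith

include hm hz hma hza H in
theorem eq_of_sum_strictConvex_le (hh : StrictConvexOn ℝ (Set.Ici 0) h)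
    (hmon : MonotoneOn h (Set.Ici 0)) (hle : ∑ i, h (m i) ≤ ∑ i, h (z i)) : m = z := by
  obtain ⟨c, hc⟩ := exists_subgradients hz hh.convexOn
  have h1 := sum_subgradient_nonneg hm hz hma hza H hmon hc
  by_contra hne
  obtain ⟨j, hj⟩ := Function.ne_iff.1 hne
  have h2 : ∑ i, c (z i) * (m i - z i) < ∑ i, (h (m i) - h (z i)) :=
    sum_lt_sum (fun i _ => hc i _ (hm i).le)
      ⟨j, mem_univ j, subgradient_lt hh (hz j) (hc j) (hm j).le hj⟩
  rw [sum_sub_distrib] at h2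
  linarith

end Convex

/-- Strict Schur concavity of the product. -/
theorem eq_of_prod_le_of_majorized {d : ℕ} {ν s : Fin d → ℝ} (hν : ∀ i, 0 < ν i)
    (hs : ∀ i, 0 < s i) (hνa : Antitone ν)
    (hpart : ∀ k ≤ d, 0 ≤ ∑ i : Fin d, if (i : ℕ) < k then s i - ν i else 0)
    (hsum : ∑ i, (s i - ν i) = 0) (hprod : ∏ i, ν i ≤ ∏ i, s i) : ν = s := by
  -- This is the gradient of `-∑ log` at `ν`: it gives `∑ (s i / ν i - 1) ≤ 0`, contradicting the
  -- strict bound by `∑ log (s i / ν i) ≥ 0` below.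
  have key : 0 ≤ ∑ i, (-(ν i)⁻¹) * (s i - ν i) :=
    sum_mul_nonneg_of_antitone _ _
      (fun i j hij => neg_le_neg (inv_anti₀ (hν j) (hνa hij))) hpart (Or.inr hsum)
  have hlog := Real.log_le_log (prod_pos fun i _ => hν i) hprod
  rw [Real.log_prod fun i _ => (hν i).ne', Real.log_prod fun i _ => (hs i).ne', ← sub_nonneg,
    ← sum_sub_distrib] at hlog
  by_contra hne
  obtain ⟨j, hj⟩ := Function.ne_iff.1 hne
  have h1 (i) : -(ν i)⁻¹ * (s i - ν i) = 1 - s i / ν i := by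
    have := (hν i).ne'
    field_simp
    ring
  have : ∑ i, (Real.log (s i) - Real.log (ν i)) < ∑ i, (s i / ν i - 1) := by
    refine sum_lt_sum (fun i _ => ?_) ⟨j, mem_univ j, ?_⟩
    · rw [← Real.log_div (hs i).ne' (hν i).ne']
      exact Real.log_le_sub_one_of_pos (div_pos (hs i) (hν i))
    · rw [← Real.log_div (hs j).ne' (hν j).ne']
      refine Real.log_lt_sub_one_of_pos (div_pos (hs j) (hν j)) fun h => hj ?_
      rw [div_eq_one_iff_eq (hν j).ne'] at h
      exact h.symm
  simp only [h1] at key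
  have h2 : ∑ i, (s i / ν i - 1) = -∑ i, (1 - s i / ν i) := by
    rw [← sum_neg_distrib]
    exact sum_congr rfl fun i _ => by ring
  linarith

/-! ### Weyl's principle and Ky Fan's inequality -/

section FiniteDim

variable {E : Type*} [NormedAddCommGroup E] [InnerProductSpace ℂ E] {d : ℕ}

theorem inner_mul_inner_eq_norm_sq (x y : E) :
    inner ℂ x y * inner ℂ y x = (‖(inner ℂ y x : ℂ)‖ : ℂ) ^ 2 := by
  rw [← inner_conj_symm x y, Complex.conj_mul']

theorem inner_basis_apply {T : E →ₗ[ℂ] E} {b : OrthonormalBasis (Fin d) ℂ E} {β : Fin d → ℝ}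
    (hb : ∀ i, T (b i) = (β i : ℂ) • b i) (j : Fin d) (x : E) :
    inner ℂ (b j) (T x) = β j * inner ℂ (b j) x := by
  conv_lhs => rw [← b.sum_repr' x]
  simp_rw [map_sum, map_smul, hb, inner_sum, inner_smul_right, b.inner_eq_ite]
  simp [mul_comm]

theorem inner_self_apply {T : E →ₗ[ℂ] E} {b : OrthonormalBasis (Fin d) ℂ E} {β : Fin d → ℝ}
    (hb : ∀ i, T (b i) = (β i : ℂ) • b i) (x : E) :
    inner ℂ x (T x) = ((∑ i, β i * ‖inner ℂ (b i) x‖ ^ 2 : ℝ) : ℂ) := by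
  rw [← b.sum_inner_mul_inner]
  push_cast
  refine sum_congr rfl fun i _ => ?_
  rw [inner_basis_apply hb, mul_left_comm, inner_mul_inner_eq_norm_sq]

theorem norm_sq_apply {T : E →ₗ[ℂ] E} {b : OrthonormalBasis (Fin d) ℂ E} {β : Fin d → ℝ}
    (hb : ∀ i, T (b i) = (β i : ℂ) • b i) (x : E) :
    ‖T x‖ ^ 2 = ∑ i, β i ^ 2 * ‖inner ℂ (b i) x‖ ^ 2 := by
  rw [← b.sum_sq_norm_inner_right]
  refine sum_congr rfl fun i _ => ?_
  rw [inner_basis_apply hb, norm_mul, mul_pow, Complex.norm_real, Real.norm_eq_abs, sq_abs]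

/-- Weyl's monotonicity principle for the ordered eigenvalues. -/
theorem eigenvalue_le_of_inner_le {T T' : E →ₗ[ℂ] E} {b b' : OrthonormalBasis (Fin d) ℂ E}
    {β β' : Fin d → ℝ} (hb : ∀ i, T (b i) = (β i : ℂ) • b i)
    (hb' : ∀ i, T' (b' i) = (β' i : ℂ) • b' i) (hβ : Antitone β) (hβ' : Antitone β')
    (hle : ∀ x, (inner ℂ x (T x)).re ≤ (inner ℂ x (T' x)).re) (j : Fin d) : β j ≤ β' j := by
  -- These are `d - 1` linear conditions, so some nonzero `x` is orthogonal to `b i` for `i > j` and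
  -- to `b' i` for `i < j`.
  let φ : E →ₗ[ℂ] ({i : Fin d // i ≠ j} → ℂ) :=
    LinearMap.pi fun i => if j < i.1 then (innerSL ℂ (b i)).toLinearMap
      else (innerSL ℂ (b' i)).toLinearMap
  have : FiniteDimensional ℂ E := b.toBasis.finiteDimensional_of_finite
  have hfin : Module.finrank ℂ ({i : Fin d // i ≠ j} → ℂ) < Module.finrank ℂ E := by
    rw [Module.finrank_eq_card_basis b.toBasis, Module.finrank_fintype_fun_eq_card]
    exact Fintype.card_subtype_lt (x := j) (by simp)
  obtain ⟨x, hx, hx0⟩ := (Submodule.ne_bot_iff _).1 (LinearMap.ker_ne_bot_of_finrank_lt hfin (f := φ))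
  have h1 (i) (hi : j < i) : inner ℂ (b i) x = 0 := by
    simpa [φ, hi] using congrFun (LinearMap.mem_ker.1 hx) ⟨i, hi.ne'⟩
  have h2 (i) (hi : i < j) : inner ℂ (b' i) x = 0 := by
    simpa [φ, hi.not_gt] using congrFun (LinearMap.mem_ker.1 hx) ⟨i, hi.ne⟩
  have h3 : β j * ‖x‖ ^ 2 ≤ (inner ℂ x (T x)).re := by
    rw [inner_self_apply hb, Complex.ofReal_re, ← b.sum_sq_norm_inner_right, mul_sum]
    refine sum_le_sum fun i _ => ?_
    rcases lt_or_ge j i with h | h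
    · simp [h1 i h]
    · exact mul_le_mul_of_nonneg_right (hβ h) (by positivity)
  have h4 : (inner ℂ x (T' x)).re ≤ β' j * ‖x‖ ^ 2 := by
    rw [inner_self_apply hb', Complex.ofReal_re, ← b'.sum_sq_norm_inner_right, mul_sum]
    refine sum_le_sum fun i _ => ?_
    rcases lt_or_ge i j with h | h
    · simp [h2 i h]
    · exact mul_le_mul_of_nonneg_right (hβ' h) (by positivity)
  have h5 : 0 < ‖x‖ ^ 2 := by positivity
  exact le_of_mul_le_mul_right (h3.trans ((hle x).trans h4)) h5

theorem sum_inner_apply_eq {T : E →ₗ[ℂ] E} {b : OrthonormalBasis (Fin d) ℂ E}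
    {β : Fin d → ℝ} (hb : ∀ i, T (b i) = (β i : ℂ) • b i) (e : OrthonormalBasis (Fin d) ℂ E) :
    ∑ i, (inner ℂ (e i) (T (e i))).re = ∑ i, β i := by
  simp_rw [inner_self_apply hb, Complex.ofReal_re]
  rw [sum_comm]
  simp_rw [← mul_sum, e.sum_sq_norm_inner_left]
  simp

theorem sum_norm_sq_apply_eq {T : E →ₗ[ℂ] E} {b : OrthonormalBasis (Fin d) ℂ E}
    {β : Fin d → ℝ} (hb : ∀ i, T (b i) = (β i : ℂ) • b i) (e : OrthonormalBasis (Fin d) ℂ E) :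
    ∑ i, ‖T (e i)‖ ^ 2 = ∑ i, β i ^ 2 := by
  simp_rw [norm_sq_apply hb]
  rw [sum_comm]
  simp_rw [← mul_sum, e.sum_sq_norm_inner_left]
  simp

/-- Ky Fan's inequality. -/
theorem sum_inner_apply_partial_le {T : E →ₗ[ℂ] E} {b : OrthonormalBasis (Fin d) ℂ E}
    {β : Fin d → ℝ} (hb : ∀ i, T (b i) = (β i : ℂ) • b i) (hβ : Antitone β)
    (e : OrthonormalBasis (Fin d) ℂ E) (k : ℕ) (hk : k ≤ d) :
    0 ≤ ∑ i : Fin d, if (i : ℕ) < k then β i - (inner ℂ (e i) (T (e i))).re else 0 := by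
  rcases k with _ | k
  · simp
  set t := β ⟨k, hk⟩ with ht
  -- The weights `D j` lie in `[0, 1]` and have the same total as the indicator `χ` of the first `k
  -- + 1` positions. Subtracting the threshold `t` from `β` is therefore free and makes each product
  -- nonnegative.
  set D : Fin d → ℝ := fun j => ∑ i : Fin d, if (i : ℕ) < k + 1 then ‖inner ℂ (b j) (e i)‖ ^ 2
    else 0 with hD
  set χ : Fin d → ℝ := fun i => if (i : ℕ) < k + 1 then 1 else 0 with hχ
  have hD0 (j) : 0 ≤ D j := sum_nonneg fun i _ => by split_ifs <;> positivity
  have hD1 (j) : D j ≤ 1 := by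
    calc D j ≤ ∑ i, ‖inner ℂ (b j) (e i)‖ ^ 2 :=
          sum_le_sum fun i _ => by split_ifs <;> [rfl; positivity]
      _ = 1 := by rw [e.sum_sq_norm_inner_left]; simp
  have hDs : ∑ j, D j = ∑ j, χ j := by
    simp only [hD, hχ]
    rw [sum_comm]
    refine sum_congr rfl fun i _ => ?_
    split_ifs
    · rw [b.sum_sq_norm_inner_right]; simp
    · simp
  have h1 : ∑ i : Fin d, (if (i : ℕ) < k + 1 then β i - (inner ℂ (e i) (T (e i))).re else 0)
      = ∑ j, β j * (χ j - D j) := by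
    simp_rw [mul_sub]
    rw [sum_sub_distrib]
    have h2 : ∑ j, β j * D j = ∑ i : Fin d, if (i : ℕ) < k + 1 then
        (inner ℂ (e i) (T (e i))).re else 0 := by
      simp only [hD, mul_sum]
      rw [sum_comm]
      refine sum_congr rfl fun i _ => ?_
      split_ifs
      · rw [inner_self_apply hb, Complex.ofReal_re]
      · simp
    rw [h2, ← sum_sub_distrib]
    refine sum_congr rfl fun i _ => ?_
    simp only [hχ]
    split_ifs <;> simp
  have h3 : ∑ j, β j * (χ j - D j) = ∑ j, (β j - t) * (χ j - D j) := by
    simp_rw [sub_mul]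
    rw [sum_sub_distrib, ← mul_sum, sum_sub_distrib, hDs]
    simp
  rw [h1, h3]
  refine sum_nonneg fun j _ => ?_
  simp only [hχ]
  split_ifs with hj
  · have : t ≤ β j := hβ (Fin.le_def.2 (by simp only; omega))
    exact mul_nonneg (by linarith) (by linarith [hD1 j])
  · have : β j ≤ t := hβ (Fin.le_def.2 (by simp only; omega))
    exact mul_nonneg_of_nonpos_of_nonpos (by linarith) (by linarith [hD0 j])

/-! ### Sums of rank one operators: multiplicative Lidskii inequality and its equality case -/

/-- The operator `∑ i, c i • u i ⊗ (u i)^*`. -/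
def weightedFrameOperator (u : Fin d → E) (c : Fin d → ℝ) : E →ₗ[ℂ] E :=
  ∑ i, (c i : ℂ) • (InnerProductSpace.rankOne ℂ (u i) (u i)).toLinearMap

theorem weightedFrameOperator_apply (u : Fin d → E) (c : Fin d → ℝ) (x : E) :
    weightedFrameOperator u c x = ∑ i, ((c i : ℂ) * inner ℂ (u i) x) • u i := by
  simp only [weightedFrameOperator, LinearMap.sum_apply, LinearMap.smul_apply,
    ContinuousLinearMap.coe_coe, InnerProductSpace.rankOne_apply, smul_smul]

theorem inner_weightedFrameOperator (u : Fin d → E) (c : Fin d → ℝ) (x : E) :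
    inner ℂ x (weightedFrameOperator u c x) =
      ((∑ i, c i * ‖inner ℂ (u i) x‖ ^ 2 : ℝ) : ℂ) := by
  rw [weightedFrameOperator_apply, inner_sum]
  push_cast
  refine sum_congr rfl fun i _ => ?_
  rw [inner_smul_right, mul_assoc, mul_comm (inner ℂ (u i) x), inner_mul_inner_eq_norm_sq]

theorem isSymmetric_weightedFrameOperator (u : Fin d → E) (c : Fin d → ℝ) :
    (weightedFrameOperator u c).IsSymmetric := by
  intro x y
  simp only [weightedFrameOperator_apply, inner_sum, sum_inner, inner_smul_left, inner_smul_right]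
  refine sum_congr rfl fun i _ => ?_
  simp
  ring

/-- The matrix is `A * diagonal c * Aᴴ` with `A` the coordinates of `u`. The constant does not
depend on `c`, so it can be read off at unit weights. -/
theorem det_weightedFrameOperator (b : OrthonormalBasis (Fin d) ℂ E) (u : Fin d → E) :
    ∃ D : ℂ, ∀ c : Fin d → ℝ, LinearMap.det (weightedFrameOperator u c) = D * ∏ i, (c i : ℂ) := by
  let A : Matrix (Fin d) (Fin d) ℂ := .of fun k i => inner ℂ (b k) (u i)
  refine ⟨A.det * A.conjTranspose.det, fun c => ?_⟩
  have : LinearMap.toMatrix b.toBasis b.toBasis (weightedFrameOperator u c) =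
      A * Matrix.diagonal (fun i => (c i : ℂ)) * A.conjTranspose := by
    ext k l
    rw [LinearMap.toMatrix_apply, Matrix.mul_apply]
    simp only [OrthonormalBasis.coe_toBasis, weightedFrameOperator_apply,
      OrthonormalBasis.coe_toBasis_repr_apply, OrthonormalBasis.repr_apply_apply, inner_sum,
      inner_smul_right, Matrix.mul_diagonal, A, Matrix.conjTranspose_apply, Matrix.of_apply]
    refine sum_congr rfl fun i _ => ?_
    rw [RCLike.star_def, inner_conj_symm]
    ring
  rw [← LinearMap.det_toMatrix b.toBasis, this, Matrix.det_mul, Matrix.det_mul,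
    Matrix.det_diagonal]
  ring

theorem det_eq_prod_of_eigenbasis {T : E →ₗ[ℂ] E} {b : OrthonormalBasis (Fin d) ℂ E}
    {β : Fin d → ℝ} (hb : ∀ i, T (b i) = (β i : ℂ) • b i) :
    LinearMap.det T = ∏ i, (β i : ℂ) := by
  have : LinearMap.toMatrix b.toBasis b.toBasis T = Matrix.diagonal fun i => (β i : ℂ) := by
    ext k l
    rw [LinearMap.toMatrix_apply]
    simp only [OrthonormalBasis.coe_toBasis, hb, OrthonormalBasis.coe_toBasis_repr_apply,
      OrthonormalBasis.repr_apply_apply, inner_smul_right, b.inner_eq_ite, Matrix.diagonal_apply]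
    split_ifs with h <;> simp [h]
  rw [← LinearMap.det_toMatrix b.toBasis, this, Matrix.det_diagonal]

theorem exists_sorted_eigenbasis {T : E →ₗ[ℂ] E} (hT : T.IsSymmetric)
    (b : OrthonormalBasis (Fin d) ℂ E) :
    ∃ (e : OrthonormalBasis (Fin d) ℂ E) (ν : Fin d → ℝ), Antitone ν ∧
      ∀ i, T (e i) = (ν i : ℂ) • e i := by
  have : FiniteDimensional ℂ E := b.toBasis.finiteDimensional_of_finite
  have hd : Module.finrank ℂ E = d := by simpa using Module.finrank_eq_card_basis b.toBasis
  exact ⟨hT.eigenvectorBasis hd, hT.eigenvalues hd, hT.eigenvalues_antitone hd,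
    hT.apply_eigenvectorBasis hd⟩

section Lidskii

variable {u : Fin d → E} {m lam β : Fin d → ℝ} {x y : OrthonormalBasis (Fin d) ℂ E}
  (hm : ∀ i, 0 < m i)
  (hlam : ∀ i, 0 < lam i) (hlama : Antitone lam)
  (hx : ∀ i, weightedFrameOperator u (fun _ => 1) (x i) = (lam i : ℂ) • x i)
  (hβa : Antitone β)
  (hy : ∀ i, weightedFrameOperator u m (y i) = (β i : ℂ) • y i)

include hx in
theorem det_eq_prod_mul_prod {c γ : Fin d → ℝ} {w : OrthonormalBasis (Fin d) ℂ E}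
    (hw : ∀ i, weightedFrameOperator u c (w i) = (γ i : ℂ) • w i) :
    ∏ i, γ i = (∏ i, lam i) * ∏ i, c i := by
  obtain ⟨D, hD⟩ := det_weightedFrameOperator x u
  have h1 := hD fun _ => 1
  rw [det_eq_prod_of_eigenbasis hx] at h1
  have h2 := hD c
  rw [det_eq_prod_of_eigenbasis hw] at h2
  simp only [Complex.ofReal_one, prod_const_one, mul_one] at h1
  rw [← h1] at h2
  exact_mod_cast h2

include hlam hlama hx hβa hy in
/-- A multiplicative Lidskii inequality, tested on truncations. -/
theorem prod_max_le_prod_max {t : ℝ} (ht : 0 < t) :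
    ∏ i, max (β i / lam i) t ≤ ∏ i, max (m i) t := by
  -- The truncated weights dominate both `m` and the constant `t`; Weyl's principle is applied to
  -- each comparison.
  obtain ⟨w, γ, hγa, hw⟩ := exists_sorted_eigenbasis
    (isSymmetric_weightedFrameOperator u fun i => max (m i) t) x
  have h1 (i) : β i ≤ γ i := by
    refine eigenvalue_le_of_inner_le hy hw hβa hγa (fun z => ?_) i
    simp only [inner_weightedFrameOperator, Complex.ofReal_re]
    exact sum_le_sum fun i _ => mul_le_mul_of_nonneg_right (le_max_left _ _) (by positivity)
  have hx' (i) : ((t : ℂ) • weightedFrameOperator u (fun _ => 1)) (x i) =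
      ((t * lam i : ℝ) : ℂ) • x i := by
    rw [LinearMap.smul_apply, hx, smul_smul, Complex.ofReal_mul]
  have h2 (i) : t * lam i ≤ γ i := by
    refine eigenvalue_le_of_inner_le hx' hw
      (fun i j hij => mul_le_mul_of_nonneg_left (hlama hij) ht.le) hγa (fun z => ?_) i
    rw [LinearMap.smul_apply, inner_smul_right, Complex.re_ofReal_mul]
    simp only [inner_weightedFrameOperator, Complex.ofReal_re, mul_sum]
    refine sum_le_sum fun i _ => ?_
    rw [one_mul]
    exact mul_le_mul_of_nonneg_right (le_max_right _ _) (by positivity)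
  have h3 := det_eq_prod_mul_prod hx hw
  refine le_of_mul_le_mul_left ?_ (prod_pos fun i (_ : i ∈ univ) => hlam i)
  rw [← h3, ← prod_mul_distrib]
  refine prod_le_prod (fun i _ => ?_) fun i _ => ?_
  · exact mul_nonneg (hlam i).le (ht.le.trans (le_max_right _ _))
  · rw [mul_max_of_nonneg _ _ (hlam i).le, mul_div_cancel₀ _ (hlam i).ne']
    exact max_le (h1 i) (by linarith [h2 i])

include hm hlam hlama hx hβa hy in
/-- The equality case: if the determinant of the sum is that of commuting operators with
equally ordered eigenvalues, there is a common ordered eigenbasis. -/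
theorem exists_common_eigenbasis (hβ : ∀ i, 0 < β i)
    (hprod : ∏ i, (1 + m i) = ∏ i, (1 + β i / lam i)) :
    ∃ e : OrthonormalBasis (Fin d) ℂ E, ∀ i,
      weightedFrameOperator u (fun _ => 1) (e i) = (lam i : ℂ) • e i ∧
      weightedFrameOperator u m (e i) = (β i : ℂ) • e i := by
  obtain ⟨e, ν, hνa, he⟩ := exists_sorted_eigenbasis
    (isSymmetric_weightedFrameOperator u fun i => 1 + m i) x
  have hadd (z) : weightedFrameOperator u (fun i => 1 + m i) z =
      weightedFrameOperator u (fun _ => 1) z + weightedFrameOperator u m z := by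
    simp only [weightedFrameOperator_apply, ← sum_add_distrib, ← add_smul]
    refine sum_congr rfl fun i _ => ?_
    push_cast
    ring_nf
  set L := weightedFrameOperator u (fun _ => 1) with hL
  set B := weightedFrameOperator u m with hB
  have hpq (i) : ν i = (inner ℂ (e i) (L (e i))).re + (inner ℂ (e i) (B (e i))).re := by
    have := congrArg (fun z => (inner ℂ (e i) z).re) (he i)
    simp only [hadd, inner_add_right, inner_smul_right] at this
    simpa using this.symm
  have hν (i) : 0 < ν i := by
    refine (hlam i).trans_le (eigenvalue_le_of_inner_le hx he hlama hνa (fun z => ?_) i)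
    simp only [hL, inner_weightedFrameOperator, Complex.ofReal_re]
    exact sum_le_sum fun i _ => mul_le_mul_of_nonneg_right (by linarith [hm i]) (by positivity)
  have hp := sum_inner_apply_partial_le hx hlama e
  have hq := sum_inner_apply_partial_le hy hβa e
  have hsplit (k : ℕ) : ∑ i : Fin d, (if (i : ℕ) < k then lam i + β i - ν i else 0) =
      (∑ i : Fin d, if (i : ℕ) < k then lam i - (inner ℂ (e i) (L (e i))).re else 0) +
      ∑ i : Fin d, if (i : ℕ) < k then β i - (inner ℂ (e i) (B (e i))).re else 0 := by
    rw [← sum_add_distrib]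
    refine sum_congr rfl fun i _ => ?_
    split_ifs
    · rw [hpq]; ring
    · simp
  -- Adding the two Ky Fan inequalities shows that `lam + β` majorizes `ν`; the traces agree, and so
  -- do the products by hypothesis.
  have hνs : ν = fun i => lam i + β i := by
    refine eq_of_prod_le_of_majorized hν (fun i => add_pos (hlam i) (hβ i)) hνa
      (fun k hk => ?_) ?_ (le_of_eq ?_)
    · rw [hsplit]
      exact add_nonneg (hp k hk) (hq k hk)
    · simp only [hpq, sum_sub_distrib, sum_add_distrib, sum_inner_apply_eq hx e,
        sum_inner_apply_eq hy e, sub_self]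
    · rw [det_eq_prod_mul_prod hx he, hprod, ← prod_mul_distrib]
      refine prod_congr rfl fun i _ => ?_
      rw [mul_add, mul_one, mul_div_cancel₀ _ (hlam i).ne']
  -- Two nonnegative Ky Fan defects now add up to zero, so each vanishes.
  have hpz (k : ℕ) (hk : k ≤ d) : ∑ i : Fin d,
      (if (i : ℕ) < k then lam i - (inner ℂ (e i) (L (e i))).re else 0) = 0 := by
    have h1 := hsplit k
    simp only [hνs, sub_self, ite_self, sum_const_zero] at h1
    linarith [hp k hk, hq k hk]
  have hpl (i : Fin d) : (inner ℂ (e i) (L (e i))).re = lam i := by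
    have h1 := hpz i i.isLt.le
    have h2 := hpz (i + 1) i.isLt
    have h3 : ∑ j : Fin d, ((if (j : ℕ) < i + 1 then lam j - (inner ℂ (e j) (L (e j))).re else 0) -
        (if (j : ℕ) < i then lam j - (inner ℂ (e j) (L (e j))).re else 0)) =
        lam i - (inner ℂ (e i) (L (e i))).re := by
      rw [sum_eq_single i]
      · simp
      · intro j _ hj
        have : (j : ℕ) ≠ i := fun h => hj (Fin.ext h)
        by_cases h : (j : ℕ) < i
        · simp [h, h.trans (Nat.lt_succ_self _)]
        · have h' : ¬ (j : ℕ) < i + 1 := by omega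
          simp [h, h']
      · simp
    rw [sum_sub_distrib, h1, h2] at h3
    linarith
  -- The diagonal of `L` in `e` is its spectrum. The Hilbert–Schmidt norm is basis independent,
  -- which leaves nothing off the diagonal.
  have hLe (i) : ‖L (e i) - (lam i : ℂ) • e i‖ ^ 2 = ‖L (e i)‖ ^ 2 - lam i ^ 2 := by
    rw [@norm_sub_sq ℂ, inner_smul_right, norm_smul, ← inner_conj_symm (L (e i))]
    simp only [RCLike.re_to_complex, Complex.re_ofReal_mul, Complex.conj_re, hpl,
      e.norm_eq_one, Complex.norm_real, Real.norm_eq_abs, mul_one, sq_abs]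
    ring
  have hz : ∑ i, ‖L (e i) - (lam i : ℂ) • e i‖ ^ 2 = 0 := by
    simp only [hLe, sum_sub_distrib, sum_norm_sq_apply_eq hx e, sub_self]
  rw [sum_eq_zero_iff_of_nonneg fun i _ => by positivity] at hz
  refine ⟨e, fun i => ?_⟩
  have h1 : L (e i) = (lam i : ℂ) • e i := by
    have := hz i (mem_univ i)
    rw [sq_eq_zero_iff, norm_eq_zero, sub_eq_zero] at this
    exact this
  refine ⟨h1, ?_⟩
  have h2 := he i
  rw [hadd, h1, hνs] at h2
  have h3 : B (e i) = ((lam i + β i : ℝ) : ℂ) • e i - (lam i : ℂ) • e i := by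
    rw [← h2]; abel
  rw [h3, ← sub_smul]
  congr 1
  push_cast
  ring

end Lidskii

end FiniteDim

section

variable {H : Type*} [NormedAddCommGroup H] [InnerProductSpace ℂ H]

/-! ### Orthonormal bases of subspaces and unitary extensions -/

section ONB

variable {d : ℕ} {x : Fin d → H} {K : Submodule ℂ H}

theorem IsONBOf.mem (hx : IsONBOf x K) (i : Fin d) : x i ∈ K :=
  hx.2 ▸ Submodule.subset_span ⟨i, rfl⟩

theorem IsONBOf.exists_basis (hx : IsONBOf x K) :
    ∃ b : OrthonormalBasis (Fin d) ℂ K, ∀ i, (b i : H) = x i := by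
  have hon : Orthonormal ℂ fun i => (⟨x i, hx.mem i⟩ : K) := by
    have := hx.1
    rw [orthonormal_iff_ite] at this ⊢
    simpa using this
  refine ⟨OrthonormalBasis.mk hon ?_, fun i => by rw [OrthonormalBasis.coe_mk]⟩
  rintro ⟨y, hy⟩ -
  rw [← Submodule.apply_mem_span_image_iff_mem_span K.injective_subtype, ← Set.range_comp]
  change y ∈ Submodule.span ℂ (Set.range x)
  rwa [hx.2]

theorem IsONBOf.finrank_eq (hx : IsONBOf x K) : Module.finrank ℂ K = d := by
  obtain ⟨b, -⟩ := hx.exists_basis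
  simpa using Module.finrank_eq_card_basis b.toBasis

theorem isONBOf_basis (b : OrthonormalBasis (Fin d) ℂ K) : IsONBOf (fun i => (b i : H)) K := by
  constructor
  · have := b.orthonormal
    rw [orthonormal_iff_ite] at this ⊢
    simpa using this
  · have h1 : Set.range (fun i => (b i : H)) = K.subtype '' Set.range b := by
      rw [← Set.range_comp]; rfl
    rw [h1, Submodule.span_image, ← b.coe_toBasis, b.toBasis.span_eq, Submodule.map_top,
      Submodule.range_subtype]

theorem isONBOf_of_orthonormal [FiniteDimensional ℂ K] (hx : Orthonormal ℂ x) (hK : ∀ i, x i ∈ K)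
    (hd : Module.finrank ℂ K = d) : IsONBOf x K := by
  refine ⟨hx, Submodule.eq_of_le_of_finrank_eq ?_ ?_⟩
  · rw [Submodule.span_le]
    rintro _ ⟨i, rfl⟩
    exact hK i
  · rw [finrank_span_eq_card hx.linearIndependent, hd, Fintype.card_fin]

theorem IsONBOf.comp_equiv (hx : IsONBOf x K) (σ : Equiv.Perm (Fin d)) : IsONBOf (x ∘ σ) K :=
  ⟨hx.1.comp σ σ.injective, by rw [σ.surjective.range_comp, hx.2]⟩

theorem IsONBOf.sum_inner_smul (hx : IsONBOf x K) {y : H} (hy : y ∈ K) :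
    ∑ i, inner ℂ (x i) y • x i = y := by
  obtain ⟨b, hb⟩ := hx.exists_basis
  have := congrArg (fun z : K => (z : H)) (b.sum_repr' ⟨y, hy⟩)
  simpa [hb] using this

theorem IsONBOf.inner_eq (hx : IsONBOf x K) (i j : Fin d) :
    inner ℂ (x i) (x j) = if i = j then 1 else 0 := orthonormal_iff_ite.1 hx.1 i j

theorem IsONBOf.ne_zero (hx : IsONBOf x K) (i : Fin d) : x i ≠ 0 := hx.1.ne_zero i

theorem IsONBOf.map (hx : IsONBOf x K) (U : H ≃ₗᵢ[ℂ] H) {L : Submodule ℂ H}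
    (hU : K.map (U.toLinearEquiv : H →ₗ[ℂ] H) = L) : IsONBOf (fun i => U (x i)) L := by
  refine ⟨hx.1.comp_linearIsometryEquiv U, ?_⟩
  rw [← hU, ← hx.2, Submodule.map_span, ← Set.range_comp]
  rfl

theorem map_eq_of_isONBOf (hx : IsONBOf x K) (U : H ≃ₗᵢ[ℂ] H) {L : Submodule ℂ H}
    (hU : IsONBOf (fun i => U (x i)) L) : K.map (U.toLinearEquiv : H →ₗ[ℂ] H) = L := by
  rw [← hU.2, ← hx.2, Submodule.map_span, ← Set.range_comp]
  rfl

/-- A change of orthonormal basis of a subspace extends to a unitary operator. -/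
theorem exists_linearIsometryEquiv_of_isONBOf [K.HasOrthogonalProjection] {y : Fin d → H}
    (hx : IsONBOf x K) (hy : IsONBOf y K) : ∃ U : H ≃ₗᵢ[ℂ] H, ∀ i, U (x i) = y i := by
  obtain ⟨b, hb⟩ := hx.exists_basis
  obtain ⟨b', hb'⟩ := hy.exists_basis
  let φ := b.equiv b' (Equiv.refl _)
  let p := K.prodEquivOfIsCompl Kᗮ K.isCompl_orthogonal
  -- The change of basis on `K`, together with the identity on `Kᗮ`.
  let U : H ≃ₗᵢ[ℂ] H :=
    { p.symm ≪≫ₗ (φ.toLinearEquiv.prodCongr (LinearEquiv.refl ℂ Kᗮ)) ≪≫ₗ p with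
      norm_map' := by
        intro z
        obtain ⟨⟨a, c⟩, rfl⟩ := p.surjective z
        have h1 (a : K) (c : Kᗮ) : ‖(a : H) + c‖ * ‖(a : H) + c‖ =
            ‖(a : H)‖ * ‖(a : H)‖ + ‖(c : H)‖ * ‖(c : H)‖ :=
          norm_add_sq_eq_norm_sq_add_norm_sq_of_inner_eq_zero _ _
            (Submodule.inner_right_of_mem_orthogonal a.2 c.2)
        have h2 : ‖(φ a : H) + c‖ = ‖(a : H) + c‖ := by
          rw [← mul_self_inj (norm_nonneg _) (norm_nonneg _), h1, h1, ← Submodule.coe_norm,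
            ← Submodule.coe_norm, φ.norm_map]
          simp only [Submodule.coe_norm]
        simpa [p] using h2 }
  refine ⟨U, fun i => ?_⟩
  have h1 : x i = p (b i, 0) := by simp [p, hb]
  change p ((φ.toLinearEquiv.prodCongr (LinearEquiv.refl ℂ Kᗮ)) (p.symm (x i))) = y i
  rw [h1, p.symm_apply_apply]
  simp [p, φ, hb']

end ONB

variable [CompleteSpace H]

/-! ### Ordered eigenvalues and frame operators -/

section EigSeq

variable {d : ℕ} {T : H →L[ℂ] H} (hT : IsSelfAdjoint T) {K : Submodule ℂ H}
  [FiniteDimensional ℂ K]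

omit [CompleteSpace H] in
theorem coe_compression_apply {y : K} (hy : T y ∈ K) : (compression T K y : H) = T y := by
  have : (compression T K y : H) = K.starProjection (T y) := rfl
  rw [this, Submodule.starProjection_eq_self_iff.2 hy]

/-- Ordered eigenvalues do not depend on the eigenbasis: Weyl's principle is applied in both
directions to the same operator. -/
theorem eigSeq_eq_padZero {e : Fin d → H} (he : IsONBOf e K) {ν : Fin d → ℝ} (hν : Antitone ν)
    (hTe : ∀ i, T (e i) = (ν i : ℂ) • e i) : eigSeq hT K = padZero ν := by
  obtain ⟨b, hb⟩ := he.exists_basis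
  obtain rfl := he.finrank_eq
  have hbT (i) : compression T K (b i) = (ν i : ℂ) • b i := by
    apply Subtype.ext
    rw [coe_compression_apply, hb, hTe, Submodule.coe_smul, hb]
    rw [hb, hTe]
    exact K.smul_mem _ (he.mem i)
  have hs := compression_isSymmetric hT K
  funext i
  unfold eigSeq padZero
  split_ifs with hi
  · exact le_antisymm
      (eigenvalue_le_of_inner_le (hs.apply_eigenvectorBasis rfl) hbT
        (hs.eigenvalues_antitone rfl) hν (fun _ => le_rfl) _)
      (eigenvalue_le_of_inner_le hbT (hs.apply_eigenvectorBasis rfl) hν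
        (hs.eigenvalues_antitone rfl) (fun _ => le_rfl) _)
  · rfl

theorem exists_isONBOf_eigSeq (hd : Module.finrank ℂ K = d) (hK : ∀ y ∈ K, T y ∈ K) :
    Antitone (fun i : Fin d => eigSeq hT K i) ∧
    ∃ e : Fin d → H, IsONBOf e K ∧ ∀ i : Fin d, T (e i) = (eigSeq hT K i : ℂ) • e i := by
  subst hd
  have hs := compression_isSymmetric hT K
  have h1 (i : Fin (Module.finrank ℂ K)) : eigSeq hT K i = hs.eigenvalues rfl i := by
    simp [eigSeq]
  refine ⟨fun i j hij => ?_, fun i => (hs.eigenvectorBasis rfl i : H), isONBOf_basis _,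
    fun i => ?_⟩
  · simp only [h1]
    exact hs.eigenvalues_antitone rfl hij
  · rw [h1, ← coe_compression_apply (hK _ (Subtype.prop _)), hs.apply_eigenvectorBasis rfl]
    rfl

end EigSeq

section Frame

variable {n d : ℕ} (F : Fin n → H)

omit [CompleteSpace H] in
theorem synthesis_apply (a : EuclideanSpace ℂ (Fin n)) : synthesis F a = ∑ i, a i • F i := by
  simp [synthesis]

theorem adjoint_synthesis_apply (y : H) (i : Fin n) :
    adjoint (synthesis F) y i = inner ℂ (F i) y := by
  have h := adjoint_inner_right (synthesis F) (EuclideanSpace.single i 1) y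
  rw [EuclideanSpace.inner_single_left] at h
  simpa [synthesis_apply] using h

theorem frameOperator_apply (y : H) : frameOperator F y = ∑ i, inner ℂ (F i) y • F i := by
  rw [frameOperator, comp_apply, synthesis_apply]
  simp only [adjoint_synthesis_apply]

theorem frameOperator_comp_apply (A : H →L[ℂ] H) (y : H) :
    frameOperator (fun i => A (F i)) y = A (frameOperator F (adjoint A y)) := by
  simp [frameOperator_apply, adjoint_inner_right]

theorem frameOperator_isometry_apply (U : H ≃ₗᵢ[ℂ] H) (y : H) :
    frameOperator (fun i => U (F i)) (U y) = U (frameOperator F y) := by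
  simp [frameOperator_apply]

theorem frameOperator_mem_span (y : H) :
    frameOperator F y ∈ Submodule.span ℂ (Set.range F) := by
  rw [frameOperator_apply]
  exact Submodule.sum_mem _ fun i _ =>
    Submodule.smul_mem _ _ (Submodule.subset_span ⟨i, rfl⟩)

theorem inner_frameOperator (y : H) :
    inner ℂ y (frameOperator F y) = ((∑ i, ‖inner ℂ (F i) y‖ ^ 2 : ℝ) : ℂ) := by
  rw [frameOperator_apply, inner_sum]
  push_cast
  refine sum_congr rfl fun i _ => ?_
  rw [inner_smul_right, mul_comm, inner_mul_inner_eq_norm_sq]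

variable {F}

/-- The range of the frame operator lies in the span, so eigenvectors with nonzero eigenvalue do
too. This identifies the space to which `frameEig` compresses. -/
theorem span_eq_of_frameOperator_eigenvectors {K : Submodule ℂ H} (hF : ∀ i, F i ∈ K)
    {e : Fin d → H} (he : IsONBOf e K) {ν : Fin d → ℝ} (hν : ∀ i, 0 < ν i)
    (hS : ∀ i, frameOperator F (e i) = (ν i : ℂ) • e i) :
    Submodule.span ℂ (Set.range F) = K := by
  refine le_antisymm (Submodule.span_le.2 ?_) ?_
  · rintro _ ⟨i, rfl⟩
    exact hF i
  · rw [← he.2, Submodule.span_le]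
    rintro _ ⟨i, rfl⟩
    have h1 := frameOperator_mem_span F (e i)
    rw [hS] at h1
    exact (Submodule.smul_mem_iff _ (by exact_mod_cast (hν i).ne')).1 h1

theorem frameEig_eq_padZero {K : Submodule ℂ H} (hF : ∀ i, F i ∈ K)
    {e : Fin d → H} (he : IsONBOf e K) {ν : Fin d → ℝ} (hν : ∀ i, 0 < ν i) (hνa : Antitone ν)
    (hS : ∀ i, frameOperator F (e i) = (ν i : ℂ) • e i) : frameEig F = padZero ν := by
  have h1 := span_eq_of_frameOperator_eigenvectors hF he hν hS
  exact eigSeq_eq_padZero _ (h1 ▸ he) hνa hS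

theorem convexPotential_eq_sum {K : Submodule ℂ H} (hF : ∀ i, F i ∈ K)
    {e : Fin d → H} (he : IsONBOf e K) {ν : Fin d → ℝ} (hν : ∀ i, 0 < ν i) (hνa : Antitone ν)
    (hS : ∀ i, frameOperator F (e i) = (ν i : ℂ) • e i) (h : ℝ → ℝ) :
    convexPotential h F = ∑ i, h (ν i) := by
  have h1 := span_eq_of_frameOperator_eigenvectors hF he hν hS
  have h2 : Module.finrank ℂ (Submodule.span ℂ (Set.range F)) = d := by
    rw [h1]; exact he.finrank_eq
  rw [convexPotential, h2, frameEig_eq_padZero hF he hν hνa hS, Finset.sum_range]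
  simp [padZero]

omit [CompleteSpace H] in
-- A nonzero vector of `W` orthogonal to every `F i` would violate the lower frame bound.
theorem IsFrameFor.span_eq {W : Submodule ℂ H} [FiniteDimensional ℂ W] (hF : IsFrameFor F W) :
    Submodule.span ℂ (Set.range F) = W := by
  obtain ⟨hm, A, B, hA, -, h⟩ := hF
  have hle : Submodule.span ℂ (Set.range F) ≤ W := by
    rw [Submodule.span_le]
    rintro _ ⟨i, rfl⟩
    exact hm i
  have : FiniteDimensional ℂ (Submodule.span ℂ (Set.range F)) :=
    finiteDimensional_span_range F
  rw [← Submodule.sup_orthogonal_inf_of_hasOrthogonalProjection hle]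
  refine left_eq_sup.2 (le_of_eq_of_le ?_ bot_le)
  rw [Submodule.eq_bot_iff]
  rintro y ⟨hy1, hy2⟩
  have h1 (i) : inner ℂ (F i) y = 0 :=
    Submodule.inner_right_of_mem_orthogonal (Submodule.subset_span (Set.mem_range_self i)) hy1
  have h2 := (h y hy2).1
  simp only [h1, norm_zero] at h2
  by_contra hy
  have : 0 < ‖y‖ := norm_pos_iff.2 hy
  have : 0 < A * ‖y‖ ^ 2 := by positivity
  simp at h2
  linarith

/-- The spectral decomposition of the frame operator of a frame for `W`. -/
theorem IsFrameFor.exists_eigenbasis {W : Submodule ℂ H} [FiniteDimensional ℂ W]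
    (hF : IsFrameFor F W) (hd : Module.finrank ℂ W = d) :
    Antitone (fun i : Fin d => frameEig F i) ∧ (∀ i : Fin d, 0 < frameEig F i) ∧
    ∃ e : Fin d → H, IsONBOf e W ∧
      ∀ i : Fin d, frameOperator F (e i) = (frameEig F i : ℂ) • e i := by
  have hs := hF.span_eq
  obtain ⟨h1, e, he, hS⟩ := exists_isONBOf_eigSeq (isSelfAdjoint_frameOperator F)
    (K := Submodule.span ℂ (Set.range F)) (d := d) (by rw [hs, hd])
    fun y _ => frameOperator_mem_span F y
  rw [hs] at he
  refine ⟨h1, fun i => ?_, e, he, hS⟩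
  obtain ⟨-, A, B, hA, -, h⟩ := hF
  have h2 := inner_frameOperator F (e i)
  rw [hS, inner_smul_right, he.inner_eq, if_pos rfl, mul_one] at h2
  have h3 := (h (e i) (he.mem i)).1
  rw [he.1.1 i] at h3
  have h4 : eigSeq (isSelfAdjoint_frameOperator F) (Submodule.span ℂ (Set.range F)) i =
      ∑ j, ‖inner ℂ (F j) (e i)‖ ^ 2 := by exact_mod_cast h2
  change 0 < eigSeq _ _ _
  rw [h4]
  linarith

end Frame

end

section

variable {H : Type*} [NormedAddCommGroup H] [InnerProductSpace ℂ H]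

/-! ### Principal vectors and the oblique projection -/

section Projections

variable {d : ℕ} {A B : Submodule ℂ H} [FiniteDimensional ℂ A] [FiniteDimensional ℂ B]

/-- Eigenvectors of `P_A P_B` in `A` are carried by `P_B` to an orthonormal basis of `B`. -/
theorem IsONBOf.exists_biorthogonal {a : Fin d → H} (ha : IsONBOf a A)
    (hd : Module.finrank ℂ B = d) {c : Fin d → ℝ} (hc : ∀ i, 0 < c i)
    (hab : ∀ i, A.starProjection (B.starProjection (a i)) = ((c i ^ 2 : ℝ) : ℂ) • a i) :
    ∃ b : Fin d → H, IsONBOf b B ∧ (∀ i, B.starProjection (a i) = (c i : ℂ) • b i) ∧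
      ∀ i, A.starProjection (b i) = (c i : ℂ) • a i := by
  have hc' (i) : (c i : ℂ) ≠ 0 := by exact_mod_cast (hc i).ne'
  refine ⟨fun i => (c i : ℂ)⁻¹ • B.starProjection (a i), ?_, fun i => ?_, fun i => ?_⟩
  · refine isONBOf_of_orthonormal ?_
      (fun i => B.smul_mem _ (B.starProjection_apply_mem _)) hd
    rw [orthonormal_iff_ite]
    intro i j
    have h1 : inner ℂ (B.starProjection (a i)) (B.starProjection (a j)) =
        ((c j ^ 2 : ℝ) : ℂ) * if i = j then 1 else 0 := by
      rw [B.inner_starProjection_left_eq_right,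
        B.starProjection_eq_self_iff.2 (B.starProjection_apply_mem _),
        ← A.starProjection_eq_self_iff.2 (ha.mem i), A.inner_starProjection_left_eq_right, hab,
        inner_smul_right, ha.inner_eq]
    rw [inner_smul_left, inner_smul_right, h1]
    split_ifs with h
    · subst h
      have := hc' i
      simp
      field_simp
    · simp
  · rw [smul_smul, mul_inv_cancel₀ (hc' i), one_smul]
  · rw [map_smul, hab, smul_smul]
    congr 1
    have := hc' i
    push_cast
    field_simp

end Projections

/-- The defect `T y - c y` is mapped by `T` to `-c` times itself, which positivity of `T` allows
only if it is zero. -/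
theorem apply_eq_smul_of_sq [CompleteSpace H] {T : H →L[ℂ] H} (hT : 0 ≤ T) {c : ℝ} (hc : 0 < c)
    {y : H} (hy : T (T y) = ((c ^ 2 : ℝ) : ℂ) • y) : T y = (c : ℂ) • y := by
  set z := T y - (c : ℂ) • y with hz
  have h1 : T z = -((c : ℂ) • z) := by
    rw [hz, map_sub, map_smul, hy, smul_sub, smul_smul]
    push_cast
    rw [sq]
    abel
  have h2 := ((nonneg_iff_isPositive T).1 hT).re_inner_nonneg_right z
  rw [h1, inner_neg_right, inner_smul_right, inner_self_eq_norm_sq_to_K] at h2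
  have h3 : 0 ≤ -(c * ‖z‖ ^ 2) := by
    refine h2.trans_eq ?_
    change Complex.re (-((c : ℂ) * ((‖z‖ : ℝ) : ℂ) ^ 2)) = _
    rw [← Complex.ofReal_pow, ← Complex.ofReal_mul, ← Complex.ofReal_neg, Complex.ofReal_re]
  have h4 : z = 0 := by
    by_contra h
    have : 0 < ‖z‖ := norm_pos_iff.2 h
    have : 0 < c * ‖z‖ ^ 2 := by positivity
    linarith
  exact sub_eq_zero.1 h4

variable [CompleteSpace H] {d : ℕ} {V W : Submodule ℂ H} [FiniteDimensional ℂ V]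
  [FiniteDimensional ℂ W]

theorem absProj_nonneg (W V : Submodule ℂ H) [FiniteDimensional ℂ W] [FiniteDimensional ℂ V] :
    0 ≤ absProj W V := CFC.abs_nonneg _

theorem absProj_absProj (W V : Submodule ℂ H) [FiniteDimensional ℂ W] [FiniteDimensional ℂ V]
    (y : H) : absProj W V (absProj W V y) =
      V.starProjection (W.starProjection (V.starProjection y)) := by
  have h := congrArg (fun T : H →L[ℂ] H => T y)
    (CFC.abs_mul_abs (W.starProjection * V.starProjection))
  have hs (K : Submodule ℂ H) [FiniteDimensional ℂ K] : star K.starProjection = K.starProjection :=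
    isSelfAdjoint_starProjection K
  have hW := W.starProjection_eq_self_iff.2 (W.starProjection_apply_mem (V.starProjection y))
  simpa [absProj, star_mul, hs, hW] using h

theorem norm_absProj (W V : Submodule ℂ H) [FiniteDimensional ℂ W] [FiniteDimensional ℂ V]
    (y : H) : ‖absProj W V y‖ = ‖W.starProjection (V.starProjection y)‖ := by
  have h1 := (isSelfAdjoint_absProj W V).isSymmetric y (absProj W V y)
  have h2 : inner ℂ (absProj W V y) (absProj W V y) =
      inner ℂ (W.starProjection (V.starProjection y)) (W.starProjection (V.starProjection y)) := by
    refine h1.trans ?_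
    rw [coe_coe, absProj_absProj, ← V.inner_starProjection_left_eq_right,
      W.inner_starProjection_left_eq_right,
      W.starProjection_eq_self_iff.2 (W.starProjection_apply_mem _)]
  rw [inner_self_eq_norm_sq_to_K, inner_self_eq_norm_sq_to_K] at h2
  have h3 : ‖absProj W V y‖ ^ 2 = ‖W.starProjection (V.starProjection y)‖ ^ 2 := by
    exact_mod_cast h2
  exact (pow_left_inj₀ (norm_nonneg _) (norm_nonneg _) two_ne_zero).1 h3

/-- The modulus is self-adjoint and, having the norms of `P_W P_V`, kills `Vᗮ`. -/
theorem absProj_mem (W V : Submodule ℂ H) [FiniteDimensional ℂ W] [FiniteDimensional ℂ V]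
    (y : H) : absProj W V y ∈ V := by
  suffices h : absProj W V y ∈ Vᗮᗮ by rwa [V.orthogonal_orthogonal] at h
  rw [Submodule.mem_orthogonal]
  intro z hz
  have h1 : absProj W V z = 0 := by
    rw [← norm_eq_zero, norm_absProj, V.starProjection_apply_eq_zero_iff.2 hz, map_zero, norm_zero]
  have h2 := (isSelfAdjoint_absProj W V).isSymmetric z y
  rw [coe_coe, h1, inner_zero_left] at h2
  exact h2.symm

omit [CompleteSpace H] [FiniteDimensional ℂ V] in
theorem eq_zero_of_starProjection_eq_zero (hVW : IsCompl V Wᗮ) {y : H} (hy : y ∈ V)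
    (h : W.starProjection y = 0) : y = 0 :=
  (Submodule.disjoint_def.1 hVW.disjoint) y hy (W.starProjection_apply_eq_zero_iff.1 h)

omit [CompleteSpace H] [FiniteDimensional ℂ V] [FiniteDimensional ℂ W] in
theorem projection_eq_zero_of_mem (hVW : IsCompl V Wᗮ) {y : H} (hy : y ∈ W)
    (h : V.projection Wᗮ hVW y = 0) : y = 0 :=
  W.orthogonal_disjoint.le_bot ⟨hy, (Submodule.projection_apply_eq_zero_iff hVW).1 h⟩

omit [CompleteSpace H] in
theorem finrank_eq_of_isCompl (hVW : IsCompl V Wᗮ) :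
    Module.finrank ℂ V = Module.finrank ℂ W := by
  apply le_antisymm
  · refine LinearMap.finrank_le_finrank_of_injective
      (f := W.orthogonalProjectionOnto.toLinearMap ∘ₗ V.subtype) ?_
    rw [← LinearMap.ker_eq_bot, LinearMap.ker_eq_bot']
    intro y hy
    apply Subtype.ext
    refine eq_zero_of_starProjection_eq_zero hVW y.2 ?_
    rw [Submodule.starProjection_apply]
    exact congrArg Subtype.val hy
  · refine LinearMap.finrank_le_finrank_of_injective
      (f := (V.projectionOnto Wᗮ hVW) ∘ₗ W.subtype) ?_
    rw [← LinearMap.ker_eq_bot, LinearMap.ker_eq_bot']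
    intro y hy
    apply Subtype.ext
    refine projection_eq_zero_of_mem hVW y.2 ?_
    rw [Submodule.projection_apply]
    exact congrArg Subtype.val hy

/-- Each eigenvalue is the norm of `P_W` at a unit vector of `V`. It is at most `1`, so `cos` undoes
`arccos`, and it is nonzero because `V` meets `Wᗮ` trivially. -/
theorem exists_eigenbasis_absProj (hVW : IsCompl V Wᗮ) (hd : Module.finrank ℂ V = d) :
    Antitone (fun i : Fin d => Real.cos (principalAngle V W i)) ∧
    (∀ i : Fin d, 0 < Real.cos (principalAngle V W i)) ∧
    ∃ v : Fin d → H, IsONBOf v V ∧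
      ∀ i : Fin d, absProj W V (v i) = (Real.cos (principalAngle V W i) : ℂ) • v i := by
  obtain ⟨h1, v, hv, hT⟩ := exists_isONBOf_eigSeq (isSelfAdjoint_absProj W V) (K := V) hd
    fun y _ => absProj_mem W V y
  have hnorm (i : Fin d) : ‖W.starProjection (v i)‖ = |eigSeq (isSelfAdjoint_absProj W V) V i| := by
    have := norm_absProj W V (v i)
    rw [hT, norm_smul, hv.1.1 i, mul_one, V.starProjection_eq_self_iff.2 (hv.mem i)] at this
    simpa using this.symm
  have hnn (i : Fin d) : 0 ≤ eigSeq (isSelfAdjoint_absProj W V) V i := by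
    have h2 := ((nonneg_iff_isPositive _).1 (absProj_nonneg W V)).re_inner_nonneg_right (v i)
    rw [hT, inner_smul_right, hv.inner_eq, if_pos rfl, mul_one] at h2
    simpa using h2
  have hcos (i : Fin d) : Real.cos (principalAngle V W i) =
      eigSeq (isSelfAdjoint_absProj W V) V i := by
    refine Real.cos_arccos (by linarith [hnn i]) ?_
    rw [← abs_of_nonneg (hnn i), ← hnorm]
    exact (W.norm_starProjection_apply_le _).trans (hv.1.1 i).le
  simp only [hcos]
  refine ⟨h1, fun i => (hnn i).lt_of_ne fun h => hv.ne_zero i ?_, v, hv, hT⟩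
  refine eq_zero_of_starProjection_eq_zero hVW (hv.mem i) ?_
  rw [← norm_eq_zero, hnorm, ← h, abs_zero]

theorem absProj_apply_of_cross {v w : H} (hv : v ∈ V) {c : ℝ} (hc : 0 < c)
    (h1 : W.starProjection v = (c : ℂ) • w) (h2 : V.starProjection w = (c : ℂ) • v) :
    absProj W V v = (c : ℂ) • v := by
  refine apply_eq_smul_of_sq (absProj_nonneg W V) hc ?_
  have := absProj_absProj W V v
  rw [V.starProjection_eq_self_iff.2 hv, h1, map_smul, h2, smul_smul] at this
  exact this.trans (by push_cast; rw [sq])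

theorem isPrincipalVectors_of_cross {v w : Fin d → H} (hv : IsONBOf v V) (hw : IsONBOf w W)
    (hc : ∀ i : Fin d, 0 < Real.cos (principalAngle V W i))
    (h1 : ∀ i : Fin d, W.starProjection (v i) = (Real.cos (principalAngle V W i) : ℂ) • w i)
    (h2 : ∀ i : Fin d, V.starProjection (w i) = (Real.cos (principalAngle V W i) : ℂ) • v i) :
    IsPrincipalVectors V W v w where
  onb_v := hv
  onb_w := hw
  abs_v i := absProj_apply_of_cross (hv.mem i) (hc i) (h1 i) (h2 i)
  abs_w i := absProj_apply_of_cross (hw.mem i) (hc i) (h2 i) (h1 i)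
  proj_v := h1
  proj_w := h2

theorem exists_isPrincipalVectors (hVW : IsCompl V Wᗮ) (hd : Module.finrank ℂ W = d) :
    ∃ v w : Fin d → H, IsPrincipalVectors V W v w := by
  obtain ⟨-, hc, v, hv, hT⟩ := exists_eigenbasis_absProj hVW ((finrank_eq_of_isCompl hVW).trans hd)
  obtain ⟨w, hw, h1, h2⟩ := hv.exists_biorthogonal hd hc fun i => by
    have := absProj_absProj W V (v i)
    rw [V.starProjection_eq_self_iff.2 (hv.mem i), hT, map_smul, hT, smul_smul] at this
    rw [← this]; push_cast; rw [sq]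
  exact ⟨v, w, isPrincipalVectors_of_cross hv hw hc h1 h2⟩

/-- The oblique projection onto `V` along `Wᗮ`, as a continuous linear map. -/
def obliqueProj (hVW : IsCompl V Wᗮ) : H →L[ℂ] H :=
  LinearMap.toContinuousLinearMap ((V.projection Wᗮ hVW) ∘ₗ W.subtype) ∘L
    W.orthogonalProjectionOnto

omit [CompleteSpace H] [FiniteDimensional ℂ V] in
-- Inserting `P_W` first changes nothing, since the oblique projection kills `Wᗮ`; passing through
-- the finite dimensional `W` is what makes continuity automatic.
theorem obliqueProj_apply (hVW : IsCompl V Wᗮ) (y : H) :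
    obliqueProj hVW y = V.projection Wᗮ hVW y := by
  have h1 : obliqueProj hVW y = V.projection Wᗮ hVW (W.starProjection y) := rfl
  rw [h1, ← sub_eq_zero, ← map_sub, Submodule.projection_apply_eq_zero_iff, ← neg_sub]
  exact Submodule.neg_mem _ (W.sub_starProjection_mem_orthogonal y)

section Principal

variable (hVW : IsCompl V Wᗮ) {v w : Fin d → H} (hp : IsPrincipalVectors V W v w)
  (hc : ∀ i : Fin d, 0 < Real.cos (principalAngle V W i))

include hp hc in
-- The oblique projection fixes `v i` and does not distinguish it from its orthogonal projection
-- `cos θ • w i` onto `W`.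
theorem obliqueProj_principal (i : Fin d) :
    obliqueProj hVW (w i) = ((Real.cos (principalAngle V W i))⁻¹ : ℂ) • v i := by
  have hc' : (Real.cos (principalAngle V W i) : ℂ) ≠ 0 := by exact_mod_cast (hc i).ne'
  have h1 : V.projection Wᗮ hVW (v i) = v i :=
    Submodule.projection_apply_left hVW ⟨v i, hp.onb_v.mem i⟩
  have h2 : V.projection Wᗮ hVW (W.starProjection (v i)) = V.projection Wᗮ hVW (v i) := by
    rw [← sub_eq_zero, ← map_sub, Submodule.projection_apply_eq_zero_iff, ← neg_sub]
    exact Submodule.neg_mem _ (W.sub_starProjection_mem_orthogonal _)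
  rw [h1, hp.proj_v, map_smul] at h2
  rw [obliqueProj_apply, ← h2, smul_smul]
  rw [inv_mul_cancel₀ hc', one_smul]

omit [FiniteDimensional ℂ V] in
theorem adjoint_obliqueProj_mem (y : H) : adjoint (obliqueProj hVW) y ∈ W := by
  suffices h : adjoint (obliqueProj hVW) y ∈ Wᗮᗮ by rwa [W.orthogonal_orthogonal] at h
  rw [Submodule.mem_orthogonal]
  intro z hz
  rw [adjoint_inner_right, obliqueProj_apply, (Submodule.projection_apply_eq_zero_iff hVW).2 hz,
    inner_zero_left]

include hp hc in
theorem adjoint_obliqueProj_principal (i : Fin d) :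
    adjoint (obliqueProj hVW) (v i) = ((Real.cos (principalAngle V W i))⁻¹ : ℂ) • w i := by
  rw [← hp.onb_w.sum_inner_smul (adjoint_obliqueProj_mem hVW (v i))]
  have h (j : Fin d) : inner ℂ (w j) (adjoint (obliqueProj hVW) (v i)) =
      ((Real.cos (principalAngle V W j))⁻¹ : ℂ) * if j = i then 1 else 0 := by
    rw [adjoint_inner_right, obliqueProj_principal hVW hp hc, inner_smul_left,
      hp.onb_v.inner_eq, map_inv₀, Complex.conj_ofReal]
  simp only [h, mul_ite, mul_one, mul_zero, ite_smul, zero_smul, sum_ite_eq', mem_univ, if_true]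

include hp hc in
theorem adjoint_obliqueProj_obliqueProj (i : Fin d) :
    adjoint (obliqueProj hVW) (obliqueProj hVW (w i)) =
      (((Real.cos (principalAngle V W i) ^ 2)⁻¹ : ℝ) : ℂ) • w i := by
  rw [obliqueProj_principal hVW hp hc, map_smul, adjoint_obliqueProj_principal hVW hp hc, smul_smul]
  congr 1
  push_cast
  rw [sq, mul_inv]

include hVW hc in
/-- Ordered eigenvectors of `P^* P` in `W`, for the oblique projection `P`, are principal. -/
theorem exists_isPrincipalVectors_of_eigenvectors (hw : IsONBOf w W)
    (hd : Module.finrank ℂ W = d)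
    (h : ∀ i : Fin d, adjoint (obliqueProj hVW) (obliqueProj hVW (w i)) =
      (((Real.cos (principalAngle V W i) ^ 2)⁻¹ : ℝ) : ℂ) • w i) :
    ∃ v, IsPrincipalVectors V W v w := by
  -- On `W`, `P_W P_V` is a left inverse of `P* P`, as any system of principal vectors shows; the
  -- given `w i` are thus eigenvectors of `P_W P_V` for `cos² θ`.
  have key (y : H) (hy : y ∈ W) : W.starProjection (V.starProjection
      (adjoint (obliqueProj hVW) (obliqueProj hVW y))) = y := by
    obtain ⟨v, w, hp⟩ := exists_isPrincipalVectors hVW hd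
    rw [← hp.onb_w.sum_inner_smul hy]
    simp only [map_sum, map_smul, adjoint_obliqueProj_obliqueProj hVW hp hc, hp.proj_w, hp.proj_v,
      smul_smul]
    refine sum_congr rfl fun i _ => ?_
    congr 1
    have : (Real.cos (principalAngle V W i) : ℂ) ≠ 0 := by exact_mod_cast (hc i).ne'
    push_cast at this ⊢
    field_simp
  obtain ⟨v, hv, h1, h2⟩ := hw.exists_biorthogonal ((finrank_eq_of_isCompl hVW).trans hd) hc
    fun i => by
      have h1 := key (w i) (hw.mem i)
      rw [h, map_smul, map_smul] at h1
      have h2 : (Real.cos (principalAngle V W i) : ℂ) ≠ 0 := by exact_mod_cast (hc i).ne'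
      conv_rhs => rw [← h1]
      rw [smul_smul]
      push_cast at h2 ⊢
      rw [mul_inv_cancel₀ (pow_ne_zero 2 h2), one_smul]
  exact ⟨v, isPrincipalVectors_of_cross hv hw hc h2 h1⟩

end Principal

end

section

/-! ### Rearrangements, diagonal operators and pseudo-inverses -/

section Rearrange

variable {d : ℕ} (z : Fin d → ℝ)

theorem rearrangeDesc_antitone : Antitone (rearrangeDesc z) := fun _ _ hij =>
  Tuple.monotone_sort z (Fin.rev_le_rev.2 hij)

theorem sum_rearrangeDesc (h : ℝ → ℝ) : ∑ i, h (rearrangeDesc z i) = ∑ i, h (z i) :=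
  Equiv.sum_comp (Fin.revPerm.trans (Tuple.sort z)) fun i => h (z i)

theorem prod_rearrangeDesc (h : ℝ → ℝ) : ∏ i, h (rearrangeDesc z i) = ∏ i, h (z i) :=
  Equiv.prod_comp (Fin.revPerm.trans (Tuple.sort z)) fun i => h (z i)

end Rearrange

variable {H : Type*} [NormedAddCommGroup H] [InnerProductSpace ℂ H] {d n : ℕ}

/-- The operator `∑ i, μ i • e i ⊗ (e i)^*`. -/
def diagOp (e : Fin d → H) (μ : Fin d → ℝ) : H →L[ℂ] H :=
  ∑ i, (μ i : ℂ) • InnerProductSpace.rankOne ℂ (e i) (e i)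

theorem diagOp_apply (e : Fin d → H) (μ : Fin d → ℝ) (y : H) :
    diagOp e μ y = ∑ i, ((μ i : ℂ) * inner ℂ (e i) y) • e i := by
  simp only [diagOp, _root_.sum_apply, _root_.smul_apply,
    InnerProductSpace.rankOne_apply, smul_smul]

theorem diagOp_mem {e : Fin d → H} {K : Submodule ℂ H} (he : IsONBOf e K) (μ : Fin d → ℝ) (y : H) :
    diagOp e μ y ∈ K := by
  rw [diagOp_apply]
  exact Submodule.sum_mem _ fun i _ => K.smul_mem _ (he.mem i)

theorem diagOp_mul {e : Fin d → H} {K : Submodule ℂ H} (he : IsONBOf e K) (μ ν : Fin d → ℝ) :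
    diagOp e μ * diagOp e ν = diagOp e (μ * ν) := by
  ext y
  change diagOp e μ (diagOp e ν y) = _
  rw [diagOp_apply e μ, diagOp_apply e ν, diagOp_apply e (μ * ν)]
  simp only [inner_sum, inner_smul_right, he.inner_eq]
  refine sum_congr rfl fun i _ => ?_
  simp [mul_assoc]

theorem inner_diagOp (e : Fin d → H) (μ : Fin d → ℝ) (y : H) :
    inner ℂ y (diagOp e μ y) = ((∑ i, μ i * ‖inner ℂ (e i) y‖ ^ 2 : ℝ) : ℂ) := by
  rw [diagOp_apply, inner_sum]
  push_cast
  refine sum_congr rfl fun i _ => ?_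
  rw [inner_smul_right, mul_assoc, mul_comm (inner ℂ (e i) y), inner_mul_inner_eq_norm_sq]

variable [CompleteSpace H]

theorem isSelfAdjoint_diagOp (e : Fin d → H) (μ : Fin d → ℝ) : IsSelfAdjoint (diagOp e μ) := by
  rw [isSelfAdjoint_iff_isSymmetric]
  intro x y
  simp only [coe_coe, diagOp_apply, inner_sum, sum_inner, inner_smul_left, inner_smul_right]
  refine sum_congr rfl fun i _ => ?_
  simp
  ring

theorem isMoorePenrose_diagOp {e : Fin d → H} {K : Submodule ℂ H} (he : IsONBOf e K)
    {μ : Fin d → ℝ} (hμ : ∀ i, μ i ≠ 0) : IsMoorePenrose (diagOp e μ) (diagOp e μ⁻¹) := by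
  have h1 : μ * μ⁻¹ = 1 := by
    ext i
    simp [hμ i]
  have h2 : μ⁻¹ * μ = 1 := by rw [mul_comm, h1]
  constructor
  · rw [diagOp_mul he, diagOp_mul he, h1, one_mul]
  · rw [diagOp_mul he, diagOp_mul he, h2, one_mul]
  · rw [diagOp_mul he]
    exact isSelfAdjoint_diagOp _ _
  · rw [diagOp_mul he]
    exact isSelfAdjoint_diagOp _ _

theorem pinv_eq {A B : H →L[ℂ] H} (h : IsMoorePenrose A B) : pinv A = B := by
  have h' : ∃ B, IsMoorePenrose A B := ⟨B, h⟩
  rw [pinv, dif_pos h']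
  exact h'.choose_spec.unique h

variable {V W : Submodule ℂ H} [FiniteDimensional ℂ V] [FiniteDimensional ℂ W]
  {F : Fin n → H} {x : Fin d → H} {lam : Fin d → ℝ}

omit [FiniteDimensional ℂ W] in
theorem frameOperator_eq_diagOp (hF : ∀ i, F i ∈ W) (hx : IsONBOf x W)
    (hS : ∀ i, frameOperator F (x i) = (lam i : ℂ) • x i) : frameOperator F = diagOp x lam := by
  ext y
  have h1 : frameOperator F y ∈ W := by
    refine (Submodule.span_le (p := W)).2 ?_ (frameOperator_mem_span F y)
    rintro _ ⟨i, rfl⟩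
    exact hF i
  rw [← hx.sum_inner_smul h1, diagOp_apply]
  refine sum_congr rfl fun i _ => ?_
  have h2 := (isSelfAdjoint_frameOperator F).isSymmetric (x i) y
  rw [coe_coe, hS, inner_smul_left, Complex.conj_ofReal] at h2
  rw [h2]

/-! ### The spectrum of the canonical dual -/

section Dual

variable (hVW : IsCompl V Wᗮ) (hF : ∀ i, F i ∈ W) (hx : IsONBOf x W) (hlam : ∀ i, 0 < lam i)
  (hS : ∀ i, frameOperator F (x i) = (lam i : ℂ) • x i)

include hF hx hlam hS

omit [FiniteDimensional ℂ V] in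
-- With `R = S†`, the dual is `P R F`, so its frame operator is `P R S R P*`, and `R S R = R` is a
-- Penrose equation.
theorem frameOperator_canonicalDual (y : H) : frameOperator (canonicalDual hVW F) y =
    obliqueProj hVW (diagOp x lam⁻¹ (adjoint (obliqueProj hVW) y)) := by
  have hmp := isMoorePenrose_diagOp hx fun i => (hlam i).ne'
  rw [← frameOperator_eq_diagOp hF hx hS] at hmp
  have h1 : canonicalDual hVW F = fun i => (obliqueProj hVW ∘L diagOp x lam⁻¹) (F i) := by
    funext i
    rw [canonicalDual, pinv_eq hmp, comp_apply, obliqueProj_apply]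
  have h2 : adjoint (diagOp x lam⁻¹) = diagOp x lam⁻¹ := (isSelfAdjoint_diagOp x lam⁻¹)
  rw [h1, frameOperator_comp_apply, adjoint_comp, h2, comp_apply, comp_apply]
  congr 1
  exact congrArg (fun T : H →L[ℂ] H => T (adjoint (obliqueProj hVW) y)) hmp.mul_mul_right

omit [CompleteSpace H] [FiniteDimensional ℂ V] [FiniteDimensional ℂ W] hF hx hlam hS in
theorem canonicalDual_mem [CompleteSpace H] (i : Fin n) : canonicalDual hVW F i ∈ V :=
  Submodule.projection_apply_mem _ _

/-- In principal vectors aligned with the eigenvectors of the frame operator, the frame operator of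
the canonical dual is diagonal. -/
theorem frameOperator_canonicalDual_principal {v w : Fin d → H} (hp : IsPrincipalVectors V W v w)
    (hc : ∀ i : Fin d, 0 < Real.cos (principalAngle V W i)) (hxw : ∀ j, x j = w j.rev)
    (j : Fin d) : frameOperator (canonicalDual hVW F) (v j) =
      (((Real.cos (principalAngle V W j) ^ 2)⁻¹ * (lam j.rev)⁻¹ : ℝ) : ℂ) • v j := by
  have h1 : diagOp x lam⁻¹ (w j) = ((lam j.rev)⁻¹ : ℂ) • w j := by
    have : w j = x j.rev := by rw [hxw, Fin.rev_rev]
    rw [this, diagOp_apply]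
    simp [hx.inner_eq]
  rw [frameOperator_canonicalDual hVW hF hx hlam hS, adjoint_obliqueProj_principal hVW hp hc,
    map_smul, h1, map_smul, map_smul, obliqueProj_principal hVW hp hc, smul_smul, smul_smul]
  congr 1
  push_cast
  rw [sq, mul_inv]
  ring

/-- The key reduction: the eigenvectors of the dual, pulled back by `P*`, are orthogonal for the
form of `S†`, and rescaling them represents `S` and `P* P` on the same vectors. -/
theorem exists_dual_eigenvalues (hd : Module.finrank ℂ W = d) :
    ∃ m : Fin d → ℝ, (∀ i, 0 < m i) ∧ Antitone m ∧
      (∀ h : ℝ → ℝ, convexPotential h (canonicalDual hVW F) = ∑ i, h (m i)) ∧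
      ∃ u : Fin d → W,
        (∀ y : W, (weightedFrameOperator u (fun _ => 1) y : H) = frameOperator F y) ∧
        ∀ y : W, (weightedFrameOperator u m y : H) =
          adjoint (obliqueProj hVW) (obliqueProj hVW y) := by
  set P := obliqueProj hVW with hP
  set R := diagOp x lam⁻¹ with hR
  have hD := frameOperator_canonicalDual hVW hF hx hlam hS
  rw [← hP, ← hR] at hD
  have hPV (y : H) : P y ∈ V := by
    rw [hP, obliqueProj_apply]
    exact Submodule.projection_apply_mem _ _
  have hPid (y : H) (hy : y ∈ V) : P y = y := by
    rw [hP, obliqueProj_apply]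
    exact Submodule.projection_apply_left hVW ⟨y, hy⟩
  have hPad (y : H) (hy : y ∈ W) : adjoint P y = y := by
    refine ext_inner_left ℂ fun z => ?_
    rw [adjoint_inner_right, ← sub_eq_zero, ← inner_sub_left]
    refine Submodule.inner_left_of_mem_orthogonal hy ?_
    rw [hP, obliqueProj_apply, ← neg_sub]
    exact Submodule.neg_mem _ (Submodule.sub_projection_mem hVW z)
  have hPmem (y : H) : adjoint P y ∈ W := adjoint_obliqueProj_mem hVW y
  obtain ⟨hma, g, hg, hDg⟩ := exists_isONBOf_eigSeq
    (isSelfAdjoint_frameOperator (canonicalDual hVW F)) (K := V)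
    ((finrank_eq_of_isCompl hVW).trans hd) fun y _ => by rw [hD]; exact hPV _
  set m : Fin d → ℝ := fun i =>
    eigSeq (isSelfAdjoint_frameOperator (canonicalDual hVW F)) V i with hm_def
  have hDm (i) : P (R (adjoint P (g i))) = (m i : ℂ) • g i := by rw [← hD, hDg]
  have hip (i j) : inner ℂ (adjoint P (g i)) (R (adjoint P (g j))) =
      (m j : ℂ) * if i = j then 1 else 0 := by
    rw [adjoint_inner_left, hDm, inner_smul_right, hg.inner_eq]
  have hm (i) : 0 < m i := by
    have h1 := hip i i
    rw [hR, inner_diagOp, if_pos rfl, mul_one] at h1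
    have h2 : ∑ k, lam⁻¹ k * ‖inner ℂ (x k) (adjoint P (g i))‖ ^ 2 = m i := by exact_mod_cast h1
    rw [← h2]
    -- A zero eigenvalue would force `P* (g i) = 0`, although `⟨g i, P* (g i)⟩ = ⟨P (g i), g i⟩ =
    -- 1`.
    refine (sum_nonneg fun k _ => ?_).lt_of_ne fun h3 => ?_
    · exact mul_nonneg (inv_nonneg.2 (hlam k).le) (by positivity)
    · have h4 := (sum_eq_zero_iff_of_nonneg fun k _ =>
        mul_nonneg (inv_nonneg.2 (hlam k).le) (by positivity)).1 h3.symm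
      have h5 (k) : inner ℂ (x k) (adjoint P (g i)) = 0 := by
        have := h4 k (mem_univ k)
        simpa [(hlam k).ne'] using this
      have h6 : adjoint P (g i) = 0 := by
        rw [← hx.sum_inner_smul (hPmem (g i))]
        simp [h5]
      have h7 : inner ℂ (g i) (adjoint P (g i)) = (1 : ℂ) := by
        rw [adjoint_inner_right, hPid _ (hg.mem i), hg.inner_eq, if_pos rfl]
      rw [h6, inner_zero_right] at h7
      exact zero_ne_one h7
  have hmc (i) : (m i : ℂ) ≠ 0 := by exact_mod_cast (hm i).ne'
  refine ⟨m, hm, hma, fun h => convexPotential_eq_sum (fun i => canonicalDual_mem hVW i) hg hm hma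
    hDg h, fun i => (((√(m i))⁻¹ : ℝ) : ℂ) • ⟨adjoint P (g i), hPmem _⟩, ?_⟩
  have hexp (c : Fin d → ℝ) (y : W) : (weightedFrameOperator (fun i => (((√(m i))⁻¹ : ℝ) : ℂ) •
      (⟨adjoint P (g i), hPmem _⟩ : W)) c y : H) =
      ∑ i, ((c i * (m i)⁻¹ : ℝ) : ℂ) • inner ℂ (adjoint P (g i)) (y : H) • adjoint P (g i) := by
    rw [weightedFrameOperator_apply, Submodule.coe_sum]
    refine sum_congr rfl fun i _ => ?_
    rw [inner_smul_left, Submodule.coe_smul, Submodule.coe_smul, smul_smul, smul_smul,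
      Submodule.coe_inner, Complex.conj_ofReal]
    congr 1
    have : (m i)⁻¹ = (√(m i))⁻¹ * (√(m i))⁻¹ := by
      rw [← mul_inv, Real.mul_self_sqrt (hm i).le]
    rw [this]
    push_cast
    ring
  have hPsum (y : H) : adjoint P y = ∑ i, inner ℂ (g i) y • adjoint P (g i) := by
    refine ext_inner_left ℂ fun z => ?_
    simp only [inner_sum, inner_smul_right, adjoint_inner_right]
    conv_lhs => rw [← hg.sum_inner_smul (hPV z)]
    rw [sum_inner]
    refine sum_congr rfl fun i _ => ?_
    rw [inner_smul_left, inner_conj_symm, mul_comm]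
  constructor
  · intro y
    rw [hexp]
    have hSmem : frameOperator F y ∈ W := by
      rw [frameOperator_eq_diagOp hF hx hS]
      exact diagOp_mem hx _ _
    have hRS : R (frameOperator F y) = y := by
      have h1 : lam⁻¹ * lam = 1 := by
        ext i
        simp [(hlam i).ne']
      rw [frameOperator_eq_diagOp hF hx hS]
      change (R * diagOp x lam) y = y
      rw [hR, diagOp_mul hx, h1, diagOp_apply]
      simpa using hx.sum_inner_smul y.2
    -- Since `P*` fixes `W`, the vector `S y` expands in the `P* (g j)`; applying `R` recovers `y`,
    -- and `hip` then reads off its coefficients.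
    have hRy : (y : H) = ∑ j, inner ℂ (g j) (frameOperator F y) • R (adjoint P (g j)) := by
      conv_lhs => rw [← hRS, ← hPad _ hSmem, hPsum, map_sum]
      simp only [map_smul]
    have h2 (i) : inner ℂ (adjoint P (g i)) (y : H) =
        (m i : ℂ) * inner ℂ (g i) (frameOperator F y) := by
      conv_lhs => rw [hRy]
      simp only [inner_sum, inner_smul_right, hip]
      simp [mul_comm]
    conv_rhs => rw [← hPad _ hSmem, hPsum]
    refine sum_congr rfl fun i _ => ?_
    rw [h2, smul_smul]
    congr 1
    push_cast
    rw [one_mul, inv_mul_cancel_left₀ (hmc i)]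
  · intro y
    rw [hexp, hPsum]
    refine sum_congr rfl fun i _ => ?_
    rw [adjoint_inner_left, mul_inv_cancel₀ (hm i).ne', Complex.ofReal_one, one_smul]

/-- The potential of every canonical dual is bounded below by the one given by principal
angles; equality for a strictly convex function forces aligned eigenvectors. -/
theorem dual_potential_bound (hd : Module.finrank ℂ W = d) (hlama : Antitone lam) {h : ℝ → ℝ}
    (hmon : MonotoneOn h (Set.Ici 0)) :
    (ConvexOn ℝ (Set.Ici 0) h →
      ∑ j : Fin d, h ((Real.cos (principalAngle V W j) ^ 2)⁻¹ * (lam j.rev)⁻¹) ≤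
        convexPotential h (canonicalDual hVW F)) ∧
    (StrictConvexOn ℝ (Set.Ici 0) h →
      convexPotential h (canonicalDual hVW F) ≤
        ∑ j : Fin d, h ((Real.cos (principalAngle V W j) ^ 2)⁻¹ * (lam j.rev)⁻¹) →
      ∃ v w : Fin d → H, IsPrincipalVectors V W v w ∧
        ∀ j, frameOperator F (w j.rev) = (lam j : ℂ) • w j.rev) := by
  obtain ⟨m, hm, hma, hpot, u, hu1, hum⟩ := exists_dual_eigenvalues hVW hF hx hlam hS hd
  obtain ⟨hcos, hc, -⟩ :=
    exists_eigenbasis_absProj hVW (W := W) ((finrank_eq_of_isCompl hVW).trans hd)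
  obtain ⟨v, w, hp⟩ := exists_isPrincipalVectors hVW hd
  obtain ⟨bx, hbx⟩ := hx.exists_basis
  obtain ⟨bw, hbw⟩ := (hp.onb_w.comp_equiv Fin.revPerm).exists_basis
  -- The cosines decrease, so the index is reversed to list the eigenvalues of `P* P` in
  -- non-increasing order, matching `lam`.
  set β : Fin d → ℝ := fun j => (Real.cos (principalAngle V W j.rev) ^ 2)⁻¹ with hβ
  have hβ0 (j) : 0 < β j := inv_pos.2 (pow_pos (hc _) 2)
  have hβa : Antitone β := fun i j hij => inv_anti₀ (pow_pos (hc _) 2)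
    (pow_le_pow_left₀ (hc _).le (hcos (Fin.rev_le_rev.2 hij)) 2)
  have hx' (i) : weightedFrameOperator u (fun _ => 1) (bx i) = (lam i : ℂ) • bx i := by
    apply Subtype.ext
    rw [hu1, Submodule.coe_smul, hbx, hS]
  have hw' (i) : weightedFrameOperator u m (bw i) = (β i : ℂ) • bw i := by
    apply Subtype.ext
    rw [hum, Submodule.coe_smul, hbw]
    exact adjoint_obliqueProj_obliqueProj hVW hp hc i.rev
  set z : Fin d → ℝ := fun i => β i / lam i with hz
  have hz0 (i) : 0 < rearrangeDesc z i := div_pos (hβ0 _) (hlam _)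
  have hH (t : ℝ) (ht : 0 < t) : ∏ i, max (rearrangeDesc z i) t ≤ ∏ i, max (m i) t := by
    rw [prod_rearrangeDesc z fun s => max s t]
    exact prod_max_le_prod_max hlam hlama hx' hβa hw' ht
  have hsum : ∑ j : Fin d, h ((Real.cos (principalAngle V W j) ^ 2)⁻¹ * (lam j.rev)⁻¹) =
      ∑ i, h (rearrangeDesc z i) := by
    rw [sum_rearrangeDesc, ← Equiv.sum_comp Fin.revPerm]
    refine sum_congr rfl fun i _ => ?_
    simp [hz, hβ, div_eq_mul_inv]
  rw [hsum, hpot]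
  refine ⟨fun hh => sum_convex_le hm hz0 hma (rearrangeDesc_antitone z) hH hh hmon,
    fun hh hle => ?_⟩
  have hmz := eq_of_sum_strictConvex_le hm hz0 hma (rearrangeDesc_antitone z) hH hh hmon hle
  -- The determinant condition ignores order, so equality of `m` with the sorted quotients suffices.
  obtain ⟨e, he⟩ := exists_common_eigenbasis hm hlam hlama hx' hβa hw' hβ0
    (by rw [hmz, prod_rearrangeDesc z fun s => 1 + s])
  have hew := (isONBOf_basis e).comp_equiv Fin.revPerm
  obtain ⟨v', hv'⟩ := exists_isPrincipalVectors_of_eigenvectors hVW hc hew hd fun i => by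
    have h1 := congrArg Subtype.val (he i.rev).2
    rw [hum, Submodule.coe_smul, hβ] at h1
    simpa using h1
  refine ⟨v', _, hv', fun j => ?_⟩
  have h1 := congrArg Subtype.val (he j).1
  rw [hu1, Submodule.coe_smul] at h1
  simpa using h1

end Dual

end

end ObliqueDual

end

/-! ### The theorem -/

open ObliqueDual in
theorem theorem4p5 {H : Type*} [NormedAddCommGroup H] [InnerProductSpace ℂ H] [CompleteSpace H]
    (V W : Submodule ℂ H) [FiniteDimensional ℂ V] [FiniteDimensional ℂ W]
    (hVW : IsCompl V Wᗮ) (d : ℕ) (hd : Module.finrank ℂ W = d)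
    (n : ℕ) (F : Fin n → H) (hF : IsFrameFor F W) :
    (∀ (v w x : Fin d → H), IsPrincipalVectors V W v w → IsONBOf x W →
      (∀ j, frameOperator F (x j) = (frameEig F j : ℂ) • x j) →
      ∀ U₀ : H ≃ₗᵢ[ℂ] H, (∀ j, U₀ (x j) = w j.rev) →
        frameEig (canonicalDual hVW fun i => U₀ (F i)) =
          padZero (rearrangeDesc fun j : Fin d =>
            (Real.cos (principalAngle V W j) ^ 2)⁻¹ * (frameEig F j.rev)⁻¹) ∧
        ∀ h : ℝ → ℝ, (∀ t, 0 ≤ t → 0 ≤ h t) → ConvexOn ℝ (Set.Ici 0) h →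
          MonotoneOn h (Set.Ici 0) →
          IsLeast (rotationPotentials hVW F h)
            (convexPotential h (canonicalDual hVW fun i => U₀ (F i)))) ∧
    (∀ h : ℝ → ℝ, (∀ t, 0 ≤ t → 0 ≤ h t) → StrictConvexOn ℝ (Set.Ici 0) h →
      MonotoneOn h (Set.Ici 0) →
      ∀ U : H ≃ₗᵢ[ℂ] H, W.map (U.toLinearEquiv : H →ₗ[ℂ] H) = W →
        IsLeast (rotationPotentials hVW F h)
          (convexPotential h (canonicalDual hVW fun i => U (F i))) →
        ∃ v' w' x' : Fin d → H, IsPrincipalVectors V W v' w' ∧ IsONBOf x' W ∧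
          (∀ j, frameOperator F (x' j) = (frameEig F j : ℂ) • x' j) ∧
          ∀ j, U (x' j) = w' j.rev) := by
  obtain ⟨hlama, hlam, e, he, hSe⟩ := hF.exists_eigenbasis hd
  obtain ⟨-, hc, -⟩ :=
    exists_eigenbasis_absProj hVW (W := W) ((finrank_eq_of_isCompl hVW).trans hd)
  have hUW {U : H ≃ₗᵢ[ℂ] H} (hU : W.map (U.toLinearEquiv : H →ₗ[ℂ] H) = W) (i) : U (F i) ∈ W :=
    hU.le (Submodule.mem_map_of_mem (hF.1 i))
  have hUS (U : H ≃ₗᵢ[ℂ] H) {x : Fin d → H}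
      (hx : ∀ j, frameOperator F (x j) = (frameEig F j : ℂ) • x j) (j) :
      frameOperator (fun i => U (F i)) (U (x j)) = (frameEig F j : ℂ) • U (x j) := by
    rw [frameOperator_isometry_apply, hx, map_smul]
  -- A rotation preserving `W` moves the eigenbasis but keeps the eigenvalues, so one lower bound
  -- serves all `U`.
  have hbound {U : H ≃ₗᵢ[ℂ] H} (hU : W.map (U.toLinearEquiv : H →ₗ[ℂ] H) = W) {h : ℝ → ℝ}
      (hmon : MonotoneOn h (Set.Ici 0)) :=
    dual_potential_bound hVW (hUW hU) (he.map U hU) hlam (hUS U hSe) hd hlama hmon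
  have hopt (v w x : Fin d → H) (hp : IsPrincipalVectors V W v w) (hx : IsONBOf x W)
      (hSx : ∀ j, frameOperator F (x j) = (frameEig F j : ℂ) • x j) (U₀ : H ≃ₗᵢ[ℂ] H)
      (hU₀ : ∀ j, U₀ (x j) = w j.rev) :
      W.map (U₀.toLinearEquiv : H →ₗ[ℂ] H) = W ∧
      frameEig (canonicalDual hVW fun i => U₀ (F i)) =
        padZero (rearrangeDesc fun j : Fin d =>
          (Real.cos (principalAngle V W j) ^ 2)⁻¹ * (frameEig F j.rev)⁻¹) ∧
      ∀ h : ℝ → ℝ, convexPotential h (canonicalDual hVW fun i => U₀ (F i)) =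
        ∑ j : Fin d, h ((Real.cos (principalAngle V W j) ^ 2)⁻¹ * (frameEig F j.rev)⁻¹) := by
    have hUx : IsONBOf (fun j => U₀ (x j)) W := by
      simp only [hU₀]
      exact hp.onb_w.comp_equiv Fin.revPerm
    have hmap := map_eq_of_isONBOf hx U₀ hUx
    have hD := frameOperator_canonicalDual_principal hVW (hUW hmap) hUx hlam (hUS U₀ hSx) hp hc hU₀
    set z : Fin d → ℝ := fun j =>
      (Real.cos (principalAngle V W j) ^ 2)⁻¹ * (frameEig F j.rev)⁻¹ with hz
    have hz0 (j) : 0 < z j := mul_pos (inv_pos.2 (pow_pos (hc j) 2)) (inv_pos.2 (hlam j.rev))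
    have hvs := hp.onb_v.comp_equiv (Fin.revPerm.trans (Tuple.sort z))
    refine ⟨hmap, ?_, fun h => ?_⟩
    · exact frameEig_eq_padZero (canonicalDual_mem hVW) hvs (fun _ => hz0 _)
        (rearrangeDesc_antitone z) fun i => hD _
    · rw [convexPotential_eq_sum (canonicalDual_mem hVW) hvs (fun _ => hz0 _)
        (rearrangeDesc_antitone z) fun i => hD _]
      exact sum_rearrangeDesc z h
  refine ⟨fun v w x hp hx hSx U₀ hU₀ => ?_, fun h _ hh hmon U hU hmin => ?_⟩
  · obtain ⟨hmap, heig, hpot⟩ := hopt v w x hp hx hSx U₀ hU₀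
    refine ⟨heig, fun h _ hh hmon => ⟨⟨U₀, hmap, rfl⟩, ?_⟩⟩
    rintro _ ⟨U, hU, rfl⟩
    rw [hpot]
    exact (hbound hU hmon).1 hh
  · obtain ⟨v, w, hp⟩ := exists_isPrincipalVectors hVW hd
    -- An aligned rotation is an admissible competitor, so the minimizer `U` has at most the optimal
    -- potential and the equality case applies to `U · F`.
    obtain ⟨U₀, hU₀⟩ := exists_linearIsometryEquiv_of_isONBOf he
      (hp.onb_w.comp_equiv Fin.revPerm)
    obtain ⟨hmap, -, hpot⟩ := hopt v w e hp he hSe U₀ hU₀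
    obtain ⟨v', w', hp', hw'⟩ := (hbound hU hmon).2 hh
      ((hmin.2 ⟨U₀, hmap, rfl⟩).trans_eq (hpot h))
    have hUsymm : W.map (U.symm.toLinearEquiv : H →ₗ[ℂ] H) = W := by
      conv_lhs => rw [← hU]
      rw [← Submodule.map_comp]
      convert Submodule.map_id W
      ext y
      exact U.symm_apply_apply y
    -- The eigenvectors found for `U · F` are transported back by `U⁻¹` to eigenvectors for `F`.
    refine ⟨v', w', fun j => U.symm (w' j.rev), hp',
      (hp'.onb_w.comp_equiv Fin.revPerm).map U.symm hUsymm, fun j => ?_,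
      fun j => U.apply_symm_apply _⟩
    apply U.injective
    rw [← frameOperator_isometry_apply, U.apply_symm_apply, hw', map_smul, U.apply_symm_apply]
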